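/- Let $d\ge 1$ be an integer and let $\gamma$ be a trace-class operator on $L^2(\mathbb{R}^d)$ (complex-valued functions) with $0\le\gamma\le 1$ and density $\rho$, i.e. $\rho(x)=\gamma(x,x)$ is the diagonal of its integral kernel, in the sense that $0\le\rho\in L^1(\mathbb{R}^d)$ and $\mathrm{Tr}(\mathbf 1_A\gamma\mathbf 1_A)=\int_A\rho$ for every measurable $A\subset\mathbb{R}^d$. Then $$\mathrm{Tr}(-\Delta)\gamma\ \ge\ C_d^{\rm TF}\,R_d\int_{\mathbb{R}^d}\rho^{1+2/d},$$ where $\mathrm{Tr}(-\Delta)\gamma\in[0,\infty]$ denotes the trace of the positive operator $-\nabla\gamma\nabla=\sum_j\partial_j^*\gamma\,\partial_j$ (equal to $+\infty$ if this operator is unbounded or not trace class), $$C_d^{\rm TF}=4\pi\,\frac{d}{d+2}\,\Gamma(1+d/2)^{2/d},$$ and $$R_d=\sup_\eta\ \frac{1}{\left(\int_0^\infty\eta(t)^2t^{d+1}\,dt\right)^{2/d}}\cdot\frac{1}{1+\frac{4}{d^2}\int_0^\infty\eta'(t)^2\,t\,dt},$$ the supremum being over all locally absolutely continuous functions $\eta:(0,\infty)\to\mathbb{R}$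 with $$\int_0^\infty\eta(t)^2\,\frac{dt}{t}=1=\int_0^\infty\eta(t)^2\,t\,dt$$ (a function $\eta$ for which $\int_0^\infty\eta^2t^{d+1}dt$ or $\int_0^\infty\eta'^2\,t\,dt$ is infinite contributes $0$). The inequality is understood in $[0,\infty]$; in particular, $\int\rho^{1+2/d}<\infty$ whenever $\mathrm{Tr}(-\Delta)\gamma<\infty$. -/

import Mathlib

open MeasureTheory Set
open scoped ENNReal InnerProductSpace SchwartzMap LineDeriv

noncomputable section

namespace LiebThirring

section Trace

variable {H : Type*} [NormedAddCommGroup H] [InnerProductSpace ℂ H]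

/-- The sum `∑ ⟨eᵢ, T eᵢ⟩ ∈ [0, ∞]` of a (positive) operator `T` over a Hilbert basis. -/
def traceOver {ι : Type*} (b : HilbertBasis ι ℂ H) (T : H →L[ℂ] H) : ℝ≥0∞ :=
  ∑' i, ENNReal.ofReal (⟪b i, T (b i)⟫_ℂ).re

theorem ofReal_sq_norm_eq_tsum {ι : Type*} (b : HilbertBasis ι ℂ H) (x : H) :
    ENNReal.ofReal (‖x‖ ^ 2) = ∑' i, ENNReal.ofReal (‖⟪b i, x⟫_ℂ‖ ^ 2) := by
  have h := (b.hasSum_inner_mul_inner x x).mapL Complex.reCLM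
  have hterm : ∀ i, Complex.reCLM (⟪x, b i⟫_ℂ * ⟪b i, x⟫_ℂ) = ‖⟪b i, x⟫_ℂ‖ ^ 2 := by
    intro i
    rw [← inner_conj_symm x (b i), Complex.conj_mul']
    simp [← Complex.ofReal_pow]
  have hx : Complex.reCLM ⟪x, x⟫_ℂ = ‖x‖ ^ 2 := by
    rw [inner_self_eq_norm_sq_to_K]
    simp [← Complex.ofReal_pow]
  simp only [hterm, hx] at h
  rw [← h.tsum_eq, ENNReal.ofReal_tsum_of_nonneg (fun i => by positivity) h.summable]

variable [CompleteSpace H]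

/-- The trace in `[0, ∞]` of a positive bounded operator on a Hilbert space. It is computed in
some Hilbert basis; by `posTrace_eq_traceOver` the choice of the basis does not matter. -/
def posTrace (T : H →L[ℂ] H) : ℝ≥0∞ :=
  traceOver (exists_hilbertBasis ℂ H).choose_spec.choose T

theorem traceOver_eq {ι κ : Type*} (b : HilbertBasis ι ℂ H) (c : HilbertBasis κ ℂ H)
    {T : H →L[ℂ] H} (hT : 0 ≤ T) : traceOver b T = traceOver c T := by
  obtain ⟨S, hS, rfl⟩ : ∃ S : H →L[ℂ] H, IsSelfAdjoint S ∧ S * S = T :=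
    ⟨CFC.sqrt T, (CFC.sqrt_nonneg T).isSelfAdjoint, CFC.sqrt_mul_sqrt_self T hT⟩
  have hsym : ∀ x y, ⟪S x, y⟫_ℂ = ⟪x, S y⟫_ℂ := hS.isSymmetric
  have key : ∀ x : H, ENNReal.ofReal (⟪x, (S * S) x⟫_ℂ).re = ENNReal.ofReal (‖S x‖ ^ 2) := by
    intro x
    rw [mul_apply_eq_comp, ← hsym, inner_self_eq_norm_sq_to_K]
    simp [← Complex.ofReal_pow]
  unfold traceOver
  simp only [key]
  calc ∑' i, ENNReal.ofReal (‖S (b i)‖ ^ 2)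
      = ∑' i, ∑' j, ENNReal.ofReal (‖⟪c j, S (b i)⟫_ℂ‖ ^ 2) := by
        simp only [← ofReal_sq_norm_eq_tsum c]
    _ = ∑' j, ∑' i, ENNReal.ofReal (‖⟪c j, S (b i)⟫_ℂ‖ ^ 2) := ENNReal.tsum_comm
    _ = ∑' j, ∑' i, ENNReal.ofReal (‖⟪b i, S (c j)⟫_ℂ‖ ^ 2) := by
        refine tsum_congr fun j => tsum_congr fun i => ?_
        rw [← hsym, ← inner_conj_symm, RCLike.norm_conj]
    _ = ∑' j, ENNReal.ofReal (‖S (c j)‖ ^ 2) := by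
        simp only [← ofReal_sq_norm_eq_tsum b]

theorem posTrace_eq_traceOver {ι : Type*} (b : HilbertBasis ι ℂ H)
    {T : H →L[ℂ] H} (hT : 0 ≤ T) : posTrace T = traceOver b T :=
  traceOver_eq _ b hT

/-- A bounded operator `T` is trace class if `Tr |T| < ∞`, where `|T| = (T* T)^{1/2}`. -/
def IsTraceClass (T : H →L[ℂ] H) : Prop :=
  posTrace (CFC.abs T) < ∞

end Trace

/-- `ℝ^d`. -/
abbrev Space (d : ℕ) : Type := EuclideanSpace ℝ (Fin d)

/-- The Hilbert space `L²(ℝ^d)` of complex-valued functions, with Lebesgue measure. -/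
abbrev L2 (d : ℕ) : Type := Lp ℂ 2 (volume : Measure (Space d))

/-- Multiplication by the characteristic function of a measurable set `A`, on `L²(ℝ^d)`. -/
def indicatorOp {d : ℕ} {A : Set (Space d)} (hA : MeasurableSet A) : L2 d →L[ℂ] L2 d :=
  LinearMap.mkContinuous
    { toFun := fun f => ((Lp.memLp f).indicator hA).toLp _
      map_add' := by
        intro f g
        rw [← MemLp.toLp_add]
        refine MemLp.toLp_congr _ _ ?_
        filter_upwards [Lp.coeFn_add f g] with x hx
        by_cases hxA : x ∈ A
        · simpa [hxA] using hx
        · simp [hxA]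
      map_smul' := by
        intro c f
        rw [RingHom.id_apply, ← MemLp.toLp_const_smul]
        refine MemLp.toLp_congr _ _ ?_
        filter_upwards [Lp.coeFn_smul c f] with x hx
        by_cases hxA : x ∈ A <;> simp [hxA, hx] }
    1 (by
      intro f
      rw [one_mul]
      refine Lp.norm_le_norm_of_ae_le ?_
      filter_upwards [((Lp.memLp f).indicator hA).coeFn_toLp] with x hx
      simp only [LinearMap.coe_mk, AddHom.coe_mk]
      rw [hx]
      exact norm_indicator_le_norm_self _ _)

/-- `ρ` is the density of the positive operator `γ` on `L²(ℝ^d)`, that is, the diagonal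
`ρ(x) = γ(x, x)` of its integral kernel. As the diagonal is a null set of `ℝ^d × ℝ^d`, this is
expressed by `Tr (1_A γ 1_A) = ∫_A ρ` for all measurable `A`. -/
structure IsDensity {d : ℕ} (γ : L2 d →L[ℂ] L2 d) (ρ : Space d → ℝ) : Prop where
  nonneg : 0 ≤ᵐ[volume] ρ
  integrable : Integrable ρ
  trace_eq : ∀ (A : Set (Space d)) (hA : MeasurableSet A),
    posTrace (indicatorOp hA * γ * indicatorOp hA) = ∫⁻ x in A, ENNReal.ofReal (ρ x)

/-- The bounded operator `K` on `L²(ℝ^d)` is `-∇ γ ∇ = ∑ⱼ ∂ⱼ* γ ∂ⱼ`, meaning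
`⟨φ, K ψ⟩ = ∑ⱼ ⟨∂ⱼ φ, γ ∂ⱼ ψ⟩` for all Schwartz functions `φ`, `ψ`. -/
def IsNegGradGrad {d : ℕ} (γ K : L2 d →L[ℂ] L2 d) : Prop :=
  ∀ φ ψ : 𝓢(Space d, ℂ),
    ⟪φ.toLp 2, K (ψ.toLp 2)⟫_ℂ =
      ∑ j : Fin d, ⟪(∂_{EuclideanSpace.single j (1 : ℝ)} φ).toLp 2,
        γ ((∂_{EuclideanSpace.single j (1 : ℝ)} ψ).toLp 2)⟫_ℂ

/-- The kinetic energy `Tr (-Δ) γ ∈ [0, ∞]` of a positive operator `γ`, understood as the trace of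
the positive operator `-∇ γ ∇`. There is at most one bounded operator `K = -∇ γ ∇`, and the value
is `∞` if there is none (the infimum over the empty set), i.e. if `-∇ γ ∇` is unbounded. -/
def kineticEnergy {d : ℕ} (γ : L2 d →L[ℂ] L2 d) : ℝ≥0∞ :=
  ⨅ (K : L2 d →L[ℂ] L2 d) (_ : IsNegGradGrad γ K), posTrace K

/-- The semiclassical (Thomas-Fermi) constant. -/
def cTF (d : ℕ) : ℝ :=
  4 * Real.pi * (d / (d + 2)) * Real.Gamma (1 + d / 2) ^ (2 / d : ℝ)

/-- `η : (0, ∞) → ℝ` (values outside of `(0, ∞)` are irrelevant) is weakly differentiable, i.e.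
locally absolutely continuous on `(0, ∞)`, and `∫₀^∞ η² dt / t = 1 = ∫₀^∞ η² t dt`. -/
structure IsNormalized (η : ℝ → ℝ) : Prop where
  locallyAC : ∀ a b : ℝ, 0 < a → a ≤ b → AbsolutelyContinuousOnInterval η a b
  norm_inv : ∫⁻ t in Ioi (0 : ℝ), ENNReal.ofReal (η t ^ 2 / t) = 1
  norm_mul : ∫⁻ t in Ioi (0 : ℝ), ENNReal.ofReal (η t ^ 2 * t) = 1

/-- The constant `R_d`, the supremum over all normalized `η` of
`(∫ η² t^{d+1} dt)^{-2/d} (1 + (4/d²) ∫ η'² t dt)⁻¹`. A function `η` for which one of the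
integrals is infinite contributes `0`. -/
def rConst (d : ℕ) : ℝ≥0∞ :=
  ⨆ (η : ℝ → ℝ) (_ : IsNormalized η),
    1 / (∫⁻ t in Ioi (0 : ℝ), ENNReal.ofReal (η t ^ 2 * t ^ (d + 1))) ^ (2 / d : ℝ) *
      (1 / (1 + ENNReal.ofReal (4 / (d : ℝ) ^ 2) *
        ∫⁻ t in Ioi (0 : ℝ), ENNReal.ofReal (deriv η t ^ 2 * t)))

end LiebThirring

end

/-! Write `γ = S²` with `S` self-adjoint, and let `uᵢ = S bᵢ` for a Hilbert basis `b`. Then `ρ = ∑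
|uᵢ|²` almost everywhere, the trace of `-∇γ∇` is `∑ ∫ |∇uᵢ|²`, and `γ ≤ 1` makes the `uᵢ` a Bessel
family.

The idea is a coherent-state argument whose momentum scale depends on the position. Let `f` be a
positive function on `{ρ ≠ 0}` and localize by `χ_t(x) = η(t / f(x))`, `t > 0`, with respect to
`dt/t`; the first normalization of `η` says `∫ χ_t² dt/t = 1`. For fixed `t`, the momentum density
`∑ |𝓕(χ_t uᵢ)(p)|²` has total mass `∫ χ_t² ρ` and, by Bessel, is at most `∫ χ_t²` pointwise. Hence
(`phase_space_bound`) `t² ∫ χ_t² ρ ≤ ∑ ∫ |∇(χ_t uᵢ)|² + ∫ (t² - 4π²|p|²)₊ dp · ∫ χ_t²`. Integrate in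
`dt/t`. By scaling and the second normalization the left side becomes `∫ f² ρ`, and the last term
becomes `A M ∫ f^(d+2)` with `M = ∫ η² t^(d+1)` and `A` the phase space volume.

The localization error is `∫ η'² t dt · ∫ |∇ log f|² ρ`. If `log f` varies at most `1/d` times as
much as `log ρ`, it is at most `(4/d²) ∫ η'² t dt · ∫ |∇√ρ|²`, and `∫ |∇√ρ|² ≤ ∑ ∫ |∇uᵢ|²`. With `f
= c ρ^(1/d)` everything is a multiple of `∫ ρ^(1+2/d)`, and the best `c` gives the constant.

No derivative of `χ_t uᵢ` is ever taken. The Dirichlet form is replaced by a Gaussian average of `∫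
|u(x+h) - u(x)|²`, whose symbol increases to `4π²|p|²`; the localization estimate is then an
inequality for pairs of points (`lintegral_norm_sq_smul_sub_smul_le`), and Fatou's lemma removes the
regularization. Finite families and truncation of `ρ` in `f` keep finite the terms that must be
subtracted. -/

namespace LiebThirring

/-! ### Fourier transform on `L²` and the Gaussian regularization of the kinetic energy -/

section Fourier

open FourierTransform Real
open scoped ContDiff

variable {E : Type*} [NormedAddCommGroup E] [InnerProductSpace ℝ E] [FiniteDimensional ℝ E]
  [MeasurableSpace E] [BorelSpace E]

theorem lintegral_enorm_sq_Lp {α : Type*} [MeasurableSpace α] {μ : Measure α} (g : Lp ℂ 2 μ) :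
    ∫⁻ x, ‖g x‖ₑ ^ 2 ∂μ = ENNReal.ofReal (‖g‖ ^ 2) := by
  rw [ENNReal.ofReal_pow (norm_nonneg _), ofReal_norm, Lp.enorm_def]
  have := eLpNorm_nnreal_pow_eq_lintegral (μ := μ) (f := g) (p := 2) two_ne_zero
  simpa using this.symm

/-- The Fourier transform on `L²`. -/
noncomputable def fourierLp (g : Lp ℂ 2 (volume : Measure E)) : Lp ℂ 2 (volume : Measure E) := 𝓕 g

theorem lintegral_enorm_sq_fourier (g : Lp ℂ 2 (volume : Measure E)) :
    ∫⁻ p, ‖fourierLp g p‖ₑ ^ 2 = ∫⁻ x, ‖g x‖ₑ ^ 2 := by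
  rw [fourierLp, lintegral_enorm_sq_Lp, lintegral_enorm_sq_Lp, Lp.norm_fourier_eq]

theorem integral_mul_fourier_Lp (g : Lp ℂ 2 (volume : Measure E)) {φ : E → ℂ} (hφ : ContDiff ℝ ∞ φ)
    (hc : HasCompactSupport φ) :
    ∫ p, φ p * fourierLp g p = ∫ x, 𝓕 φ x * g x := by
  have h := DFunLike.congr_fun (Lp.fourier_toTemperedDistribution_eq g) (hc.toSchwartzMap hφ)
  rw [TemperedDistribution.fourier_apply, Lp.toTemperedDistribution_apply,
    Lp.toTemperedDistribution_apply] at h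
  rw [SchwartzMap.fourier_coe] at h
  exact h.symm

/-- The multiplication formula against test functions determines the `L²` Fourier transform; the
integral formula and the translation rule are both derived from this criterion. -/
theorem ae_eq_fourier_Lp (g : Lp ℂ 2 (volume : Measure E)) {w : E → ℂ} (hw : LocallyIntegrable w)
    (h : ∀ φ : E → ℂ, ContDiff ℝ ∞ φ → HasCompactSupport φ →
      ∫ p, φ p * w p = ∫ x, 𝓕 φ x * g x) :
    w =ᵐ[volume] fourierLp g := by
  refine ae_eq_of_integral_contDiff_smul_eq hw
    ((Lp.memLp _).locallyIntegrable (by norm_num)) fun φ hφ hc => ?_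
  have hφ' : ContDiff ℝ ∞ (fun x => (φ x : ℂ)) := Complex.ofRealCLM.contDiff.comp hφ
  have hc' : HasCompactSupport (fun x => (φ x : ℂ)) := hc.comp_left (g := Complex.ofReal) rfl
  have h1 := h _ hφ' hc'
  rw [← integral_mul_fourier_Lp g hφ' hc'] at h1
  simpa [Complex.real_smul] using h1

theorem fourier_Lp_of_integrable {g : E → ℂ} (hg : MemLp g 2) (hg1 : Integrable g) :
    𝓕 g =ᵐ[volume] fourierLp hg.toLp := by
  have hcont : Continuous (𝓕 g) :=
    VectorFourier.fourierIntegral_continuous Real.continuous_fourierChar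
      (by exact continuous_inner) hg1
  refine ae_eq_fourier_Lp _ hcont.locallyIntegrable fun φ hφ hc => ?_
  have hφ1 : Integrable φ := hφ.continuous.integrable_of_hasCompactSupport hc
  have := VectorFourier.integral_fourierIntegral_smul_eq_flip (μ := (volume : Measure E))
    (ν := (volume : Measure E)) (L := innerₗ E) (e := Real.fourierChar)
    Real.continuous_fourierChar (by exact continuous_inner) hφ1 hg1
  rw [flip_innerₗ] at this
  simp only [smul_eq_mul] at this
  refine Eq.trans (this.symm) (integral_congr_ae ?_)
  filter_upwards [hg.coeFn_toLp] with x hx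
  rw [hx]; rfl

theorem fourier_Lp_translate {g gh : Lp ℂ 2 (volume : Measure E)} {h : E}
    (hgh : gh =ᵐ[volume] fun x => g (x + h)) :
    (fun p => ((Real.fourierChar ⟪h, p⟫_ℝ : Circle) : ℂ) * fourierLp g p) =ᵐ[volume]
      fourierLp gh := by
  have hchar : ContDiff ℝ ∞ (fun p : E => ((Real.fourierChar ⟪h, p⟫_ℝ : Circle) : ℂ)) := by
    simp only [Real.fourierChar_apply]
    have : ContDiff ℝ ∞ (fun p : E => ((2 * π * ⟪h, p⟫_ℝ : ℝ) : ℂ)) :=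
      Complex.ofRealCLM.contDiff.comp (contDiff_const.mul (contDiff_const.inner ℝ contDiff_id))
    fun_prop
  refine ae_eq_fourier_Lp _ ?_ fun φ hφ hc => ?_
  · refine MemLp.locallyIntegrable (p := 2) ?_ (by norm_num)
    refine (Lp.memLp (fourierLp g)).of_le
      (hchar.continuous.aestronglyMeasurable.mul (Lp.aestronglyMeasurable _)) ?_
    exact Filter.Eventually.of_forall fun p => by
      rw [norm_mul, Circle.norm_coe, one_mul]
  · have h1 := integral_mul_fourier_Lp g (φ := fun p => φ p * ((Real.fourierChar ⟪h, p⟫_ℝ : Circle) : ℂ))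
      (hφ.mul hchar) hc.mul_right
    simp only [mul_assoc] at h1
    rw [h1]
    have h2 : ∀ x, 𝓕 (fun p => φ p * ((Real.fourierChar ⟪h, p⟫_ℝ : Circle) : ℂ)) x = 𝓕 φ (x - h) := by
      intro x
      rw [Real.fourier_eq, Real.fourier_eq]
      refine integral_congr_ae (Filter.Eventually.of_forall fun p => ?_)
      simp only [Circle.smul_def, smul_eq_mul]
      rw [mul_comm (φ p), ← mul_assoc, ← Circle.coe_mul, ← AddChar.map_add_eq_mul]
      congr 3
      rw [inner_sub_right, real_inner_comm h p]
      ring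
    simp only [h2]
    rw [← integral_add_right_eq_self _ h]
    refine integral_congr_ae ?_
    filter_upwards [hgh] with x hx
    simp [hx]

/-- Plancherel: translation by `h` becomes multiplication by a character. -/
theorem lintegral_enorm_sq_translate_sub {u : E → ℂ} (hu : MemLp u 2) (h : E) :
    ∫⁻ x, ‖u (x + h) - u x‖ₑ ^ 2 =
      ∫⁻ p, ‖((Real.fourierChar ⟪h, p⟫_ℝ : Circle) : ℂ) - 1‖ₑ ^ 2 *
        ‖fourierLp hu.toLp p‖ₑ ^ 2 := by
  have hmp : MeasurePreserving (fun x : E => x + h) := measurePreserving_add_right volume h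
  have huh : MemLp (fun x => u (x + h)) 2 := hu.comp_measurePreserving hmp
  have h1 : huh.toLp =ᵐ[volume] fun x => hu.toLp u (x + h) := by
    refine huh.coeFn_toLp.trans ?_
    exact (hmp.quasiMeasurePreserving.ae_eq_comp hu.coeFn_toLp).symm
  have h2 := fourier_Lp_translate h1
  have h3 := lintegral_enorm_sq_fourier (huh.toLp - hu.toLp)
  have h4 : fourierLp (huh.toLp - hu.toLp) = fourierLp huh.toLp - fourierLp hu.toLp := by
    exact map_sub (Lp.fourierTransformₗᵢ E ℂ) _ _
  rw [h4] at h3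
  calc _ = ∫⁻ x, ‖(huh.toLp - hu.toLp) x‖ₑ ^ 2 := by
        refine lintegral_congr_ae ?_
        filter_upwards [Lp.coeFn_sub huh.toLp hu.toLp, huh.coeFn_toLp, hu.coeFn_toLp]
          with x a b c
        rw [a, Pi.sub_apply, b, c]
    _ = _ := by
        rw [← h3]
        refine lintegral_congr_ae ?_
        filter_upwards [Lp.coeFn_sub (fourierLp huh.toLp) (fourierLp hu.toLp), h2] with p a b
        rw [a, Pi.sub_apply, ← b, ← mul_pow, ← enorm_mul, sub_mul, one_mul]

/-- The function `x ↦ b (1 - exp (-x / b))`, which increases to `x` as `b → ∞`. -/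
noncomputable def expSymbol (b x : ℝ) : ℝ := b * (1 - Real.exp (-x / b))

/-- A Gaussian, normalized such that its energy form has the symbol `expSymbol (4 b)`. -/
noncomputable def heatKernel (b : ℝ) (h : E) : ℝ :=
  2 * b / (∫ v : E, Real.exp (-b * ‖v‖ ^ 2)) * Real.exp (-b * ‖h‖ ^ 2)

theorem fourier_real_gaussian {b : ℝ} (hb : 0 < b) (p : E) :
    𝓕 (fun v : E => ((Real.exp (-b * ‖v‖ ^ 2) : ℝ) : ℂ)) p =
      ((∫ v : E, Real.exp (-b * ‖v‖ ^ 2)) * Real.exp (-(4 * π ^ 2 * ‖p‖ ^ 2) / (4 * b)) : ℝ) := by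
  have h (w : E) := fourier_gaussian_innerProductSpace (V := E) (b := (b : ℂ)) (by simpa) w
  have h0 : 𝓕 (fun v : E => Complex.exp (-b * ‖v‖ ^ 2)) 0 =
      ((∫ v : E, Real.exp (-b * ‖v‖ ^ 2) : ℝ) : ℂ) := by
    rw [Real.fourier_eq, ← integral_complex_ofReal]
    simp
  -- Evaluating at `0` identifies the prefactor of the transform with the integral of the Gaussian,
  -- so its explicit value is never needed.
  have h1 := h 0
  rw [h0] at h1
  simp only [norm_zero, Complex.ofReal_zero, ne_eq, OfNat.ofNat_ne_zero, not_false_eq_true,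
    zero_pow, mul_zero, zero_div, Complex.exp_zero, mul_one] at h1
  have h2 := h p
  rw [← h1] at h2
  push_cast at h2 ⊢
  rw [h2]
  congr 2
  field_simp

theorem integrable_real_gaussian {b : ℝ} (hb : 0 < b) :
    Integrable (fun v : E => Real.exp (-b * ‖v‖ ^ 2)) := by
  have := GaussianFourier.integrable_cexp_neg_mul_sq_norm_add (V := E) (b := (b : ℂ))
    (by simpa) 0 0
  refine this.norm.congr (Filter.Eventually.of_forall fun v => ?_)
  simp [Complex.norm_exp, ← Complex.ofReal_pow]

theorem integral_real_gaussian_pos {b : ℝ} (hb : 0 < b) :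
    0 < ∫ v : E, Real.exp (-b * ‖v‖ ^ 2) :=
  integral_exp_pos (integrable_real_gaussian hb)

theorem heatKernel_nonneg {b : ℝ} (hb : 0 < b) (h : E) : 0 ≤ heatKernel b h := by
  have := integral_real_gaussian_pos (E := E) hb
  unfold heatKernel
  positivity

theorem continuous_heatKernel (b : ℝ) : Continuous (heatKernel (E := E) b) := by
  unfold heatKernel
  fun_prop

theorem norm_fourierChar_sub_one_sq (x : ℝ) :
    ‖((Real.fourierChar x : Circle) : ℂ) - 1‖ ^ 2 = 2 - 2 * ((Real.fourierChar (-x) : Circle) : ℂ).re := by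
  rw [← Complex.normSq_eq_norm_sq, Complex.normSq_sub, Complex.normSq_eq_norm_sq]
  rw [Circle.norm_coe]
  simp [AddChar.map_neg_eq_inv]
  norm_num

/-- Since `|e^{iθ} - 1|² = 2 - 2 cos θ`, the integral is the difference between the Fourier
transform of the Gaussian at `0` and at `p`, up to the normalization. -/
theorem lintegral_heatKernel_mul {b : ℝ} (hb : 0 < b) (p : E) :
    ∫⁻ h, ENNReal.ofReal (heatKernel b h) * ‖((Real.fourierChar ⟪h, p⟫_ℝ : Circle) : ℂ) - 1‖ₑ ^ 2 =
      ENNReal.ofReal (expSymbol (4 * b) (4 * π ^ 2 * ‖p‖ ^ 2)) := by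
  have hW := integral_real_gaussian_pos (E := E) hb
  have hI := integrable_real_gaussian (E := E) hb
  set W := ∫ v : E, Real.exp (-b * ‖v‖ ^ 2) with hWdef
  have hF := congrArg Complex.re (fourier_real_gaussian (E := E) hb p)
  have hJ : Integrable fun v : E =>
      (Real.fourierChar (-⟪v, p⟫_ℝ)) • ((Real.exp (-b * ‖v‖ ^ 2) : ℝ) : ℂ) := by
    refine (Real.fourierIntegral_convergent_iff p).2 hI.ofReal
  rw [Complex.ofReal_re, Real.fourier_eq, ← RCLike.re_eq_complex_re, ← integral_re hJ] at hF
  have key : ∀ h : E, heatKernel b h * ‖((Real.fourierChar ⟪h, p⟫_ℝ : Circle) : ℂ) - 1‖ ^ 2 =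
      4 * b / W * (Real.exp (-b * ‖h‖ ^ 2) - RCLike.re ((Real.fourierChar (-⟪h, p⟫_ℝ)) •
        ((Real.exp (-b * ‖h‖ ^ 2) : ℝ) : ℂ))) := by
    intro h
    rw [norm_fourierChar_sub_one_sq, heatKernel, ← hWdef, Circle.smul_def, smul_eq_mul,
      RCLike.re_eq_complex_re, Complex.re_mul_ofReal]
    ring
  calc _ = ∫⁻ h, ENNReal.ofReal (heatKernel b h * ‖((Real.fourierChar ⟪h, p⟫_ℝ : Circle) : ℂ) - 1‖ ^ 2) := by
        refine lintegral_congr fun h => ?_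
        rw [ENNReal.ofReal_mul (heatKernel_nonneg hb h), ENNReal.ofReal_pow (norm_nonneg _),
          ofReal_norm]
    _ = _ := by
        rw [← ofReal_integral_eq_lintegral_ofReal]
        · simp only [key]
          rw [integral_const_mul, integral_sub hI hJ.re, hF, ← hWdef, expSymbol]
          congr 1
          field_simp
        · simp only [key]
          exact (hI.sub hJ.re).const_mul _
        · exact Filter.Eventually.of_forall fun h =>
            mul_nonneg (heatKernel_nonneg hb h) (by positivity)

/-- The energy form of the Gaussian `heatKernel b`. -/
noncomputable def heatEnergy (b : ℝ) (u : E → ℂ) : ℝ≥0∞ :=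
  ∫⁻ h, ENNReal.ofReal (heatKernel b h) * ∫⁻ x, ‖u (x + h) - u x‖ₑ ^ 2

theorem lintegral_mul_lintegral_mul {α β : Type*} [MeasurableSpace α] [MeasurableSpace β]
    {μ : Measure α} {ν : Measure β} [SFinite μ] [SFinite ν] {G : α → ℝ≥0∞} {k : α → β → ℝ≥0∞}
    {F : β → ℝ≥0∞} (hG : Measurable G) (hk : Measurable (Function.uncurry k)) (hF : Measurable F) :
    ∫⁻ h, G h * ∫⁻ p, k h p * F p ∂ν ∂μ = ∫⁻ p, (∫⁻ h, G h * k h p ∂μ) * F p ∂ν := by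
  have hk1 (h : α) : Measurable fun p => k h p := hk.comp measurable_prodMk_left
  have hk2 (p : β) : Measurable fun h => k h p := hk.comp measurable_prodMk_right
  have h1 : ∀ h, G h * ∫⁻ p, k h p * F p ∂ν = ∫⁻ p, G h * k h p * F p ∂ν := by
    intro h
    rw [← lintegral_const_mul _ (by fun_prop)]
    simp only [mul_assoc]
  simp only [h1]
  rw [lintegral_lintegral_swap]
  · exact lintegral_congr fun p => lintegral_mul_const _ (by fun_prop)
  · exact (((hG.comp measurable_fst).mul hk).mul (hF.comp measurable_snd)).aemeasurable

/-- Tonelli after Plancherel in `x`. Only `u ∈ L²` is needed, so this applies to the localized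
functions, whose cutoffs are merely measurable. -/
theorem heatEnergy_eq {b : ℝ} (hb : 0 < b) {u : E → ℂ} (hu : MemLp u 2) :
    heatEnergy b u = ∫⁻ p, ENNReal.ofReal (expSymbol (4 * b) (4 * π ^ 2 * ‖p‖ ^ 2)) *
      ‖fourierLp hu.toLp p‖ₑ ^ 2 := by
  unfold heatEnergy
  simp only [lintegral_enorm_sq_translate_sub hu, ← lintegral_heatKernel_mul hb]
  have hchar : Continuous fun z : E × E => ((Real.fourierChar ⟪z.1, z.2⟫_ℝ : Circle) : ℂ) - 1 := by
    simp only [Real.fourierChar_apply]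
    fun_prop
  exact lintegral_mul_lintegral_mul (continuous_heatKernel b).measurable.ennreal_ofReal
    (k := fun h p => ‖((Real.fourierChar ⟪h, p⟫_ℝ : Circle) : ℂ) - 1‖ₑ ^ 2)
    (hchar.measurable.enorm.pow_const 2) ((Lp.stronglyMeasurable _).measurable.enorm.pow_const 2)

theorem expSymbol_nonneg {b x : ℝ} (hb : 0 < b) (hx : 0 ≤ x) : 0 ≤ expSymbol b x := by
  have : Real.exp (-x / b) ≤ 1 := Real.exp_le_one_iff.2 (div_nonpos_of_nonpos_of_nonneg
    (by linarith) hb.le)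
  exact mul_nonneg hb.le (by linarith)

/-- The difference is `e^{-y/b}` times the symbol at `x - y`, and `1 - e^{-s} ≤ s`. Thus the
regularized symbol can be compared with the sharp weight `(t² - 4π²|p|²)₊` without loss for any `b`.
-/
theorem expSymbol_sub_le {b x y : ℝ} (hb : 0 < b) (hy : 0 ≤ y) :
    expSymbol b x - expSymbol b y ≤ max (x - y) 0 := by
  have e : expSymbol b x - expSymbol b y =
      Real.exp (-y / b) * (b * (1 - Real.exp (-(x - y) / b))) := by
    have : Real.exp (-x / b) = Real.exp (-y / b) * Real.exp (-(x - y) / b) := by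
      rw [← Real.exp_add]; congr 1; ring
    unfold expSymbol
    rw [this]; ring
  have h1 : Real.exp (-y / b) ≤ 1 := Real.exp_le_one_iff.2 (div_nonpos_of_nonpos_of_nonneg
    (by linarith) hb.le)
  have h2 : b * (1 - Real.exp (-(x - y) / b)) ≤ x - y := by
    have := Real.add_one_le_exp (-(x - y) / b)
    calc b * (1 - Real.exp (-(x - y) / b)) ≤ b * ((x - y) / b) := by
          refine mul_le_mul_of_nonneg_left ?_ hb.le
          rw [neg_div] at this ⊢
          linarith
      _ = x - y := by field_simp
  rw [e]
  calc _ ≤ Real.exp (-y / b) * max (x - y) 0 :=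
        mul_le_mul_of_nonneg_left (h2.trans (le_max_left _ _)) (Real.exp_pos _).le
    _ ≤ 1 * max (x - y) 0 := mul_le_mul_of_nonneg_right h1 (le_max_right _ _)
    _ = _ := one_mul _

theorem expSymbol_le {b x : ℝ} (hb : 0 < b) (hx : 0 ≤ x) : expSymbol b x ≤ x := by
  have := expSymbol_sub_le (x := x) hb le_rfl
  simpa [expSymbol, hx] using this

theorem tendsto_expSymbol (x : ℝ) :
    Filter.Tendsto (fun b => expSymbol b x) Filter.atTop (nhds x) := by
  -- With `s = 1 / b`, the symbol is a difference quotient of this function at `0`.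
  have h : HasDerivAt (fun s : ℝ => 1 - Real.exp (-x * s)) x 0 := by
    have := (((hasDerivAt_id (0 : ℝ)).const_mul (-x)).exp).const_sub 1
    simpa using this
  have h2 := h.tendsto_slope.comp (tendsto_inv_atTop_nhdsGT_zero.mono_right
    (nhdsWithin_mono (0 : ℝ) fun y (hy : 0 < y) => hy.ne'))
  refine h2.congr' ?_
  filter_upwards [Filter.eventually_gt_atTop 0] with b hb
  simp [slope, expSymbol, div_eq_mul_inv]

end Fourier

/-! ### Profiles `η` under dilations and the measure `dt / t` -/

section Profile

open Real

/-- The measure `dt / t` on `(0, ∞)`. -/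
noncomputable def haarIoi : Measure ℝ :=
  (volume.restrict (Ioi 0)).withDensity fun t => ENNReal.ofReal (1 / t)

instance : SFinite haarIoi := by unfold haarIoi; infer_instance

theorem lintegral_haarIoi {f : ℝ → ℝ≥0∞} (hf : Measurable f) :
    ∫⁻ t, f t ∂haarIoi = ∫⁻ t in Ioi (0 : ℝ), ENNReal.ofReal (1 / t) * f t := by
  unfold haarIoi
  rw [lintegral_withDensity_eq_lintegral_mul _ (by fun_prop) hf]
  rfl

theorem lintegral_haarIoi_div {f : ℝ → ℝ≥0∞} (hf : Measurable f) {a : ℝ} (ha : 0 < a) :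
    ∫⁻ t, f (t / a) ∂haarIoi = ∫⁻ t, f t ∂haarIoi := by
  rw [lintegral_haarIoi hf, lintegral_haarIoi (f := fun t => f (t / a)) (by fun_prop)]
  have himg : (fun t : ℝ => a * t) '' Ioi 0 = Ioi 0 := by
    simpa using image_mul_left_Ioi ha (0 : ℝ)
  rw [← himg, lintegral_image_eq_lintegral_abs_deriv_mul measurableSet_Ioi
    (f' := fun _ => a) (fun t _ => by simpa using ((hasDerivAt_id t).const_mul a).hasDerivWithinAt)
    ((mul_right_injective₀ ha.ne').injOn), himg]
  refine setLIntegral_congr_fun measurableSet_Ioi fun t (ht : 0 < t) => ?_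
  rw [← mul_assoc, ← ENNReal.ofReal_mul (abs_nonneg _), mul_div_cancel_left₀ _ ha.ne',
    abs_of_pos ha]
  congr 2
  field_simp

/-- The restriction of `η` to `(0, ∞)`, extended by zero. -/
noncomputable def posPart (η : ℝ → ℝ) : ℝ → ℝ := (Ioi 0).indicator η

theorem posPart_of_pos (η : ℝ → ℝ) {t : ℝ} (ht : 0 < t) : posPart η t = η t :=
  indicator_of_mem ht _

theorem posPart_zero (η : ℝ → ℝ) : posPart η 0 = 0 := by simp [posPart]

theorem IsNormalized.continuousOn {η : ℝ → ℝ} (hη : IsNormalized η) : ContinuousOn η (Ioi 0) := by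
  intro t (ht : 0 < t)
  have h := (hη.locallyAC (t / 2) (2 * t) (by positivity) (by linarith)).continuousOn
  rw [uIcc_of_le (by linarith)] at h
  exact (h.continuousAt (Icc_mem_nhds (by linarith) (by linarith))).continuousWithinAt

theorem IsNormalized.measurable_posPart {η : ℝ → ℝ} (hη : IsNormalized η) :
    Measurable (posPart η) := by
  have h := hη.continuousOn.measurable_piecewise (g := fun _ => (0 : ℝ)) continuousOn_const
    measurableSet_Ioi
  convert h using 1
  exact (piecewise_eq_indicator).symm

theorem lintegral_haarIoi_ofReal {f : ℝ → ℝ} (hf : Measurable f) :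
    ∫⁻ t, ENNReal.ofReal (f t) ∂haarIoi = ∫⁻ t in Ioi (0 : ℝ), ENNReal.ofReal (f t / t) := by
  rw [lintegral_haarIoi hf.ennreal_ofReal]
  refine setLIntegral_congr_fun measurableSet_Ioi fun t (ht : 0 < t) => ?_
  rw [← ENNReal.ofReal_mul (by positivity), one_div_mul_eq_div]

theorem lintegral_sq_mul_pow {η : ℝ → ℝ} (hη : IsNormalized η) {a : ℝ} (ha : 0 < a) (n : ℕ) :
    ∫⁻ t, ENNReal.ofReal (posPart η (t / a) ^ 2 * t ^ (n + 1)) ∂haarIoi =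
      ENNReal.ofReal (a ^ (n + 1)) * ∫⁻ t in Ioi (0 : ℝ), ENNReal.ofReal (η t ^ 2 * t ^ n) := by
  have hm := hη.measurable_posPart
  have h1 : ∀ t, ENNReal.ofReal (posPart η (t / a) ^ 2 * t ^ (n + 1)) =
      ENNReal.ofReal (a ^ (n + 1)) *
        ENNReal.ofReal (posPart η (t / a) ^ 2 * (t / a) ^ (n + 1)) := by
    intro t
    rw [← ENNReal.ofReal_mul (by positivity)]
    rw [mul_left_comm, ← mul_pow, mul_div_cancel₀ _ ha.ne']
  simp only [h1]
  rw [lintegral_const_mul _ (by fun_prop)]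
  congr 1
  rw [lintegral_haarIoi_div (f := fun t => ENNReal.ofReal (posPart η t ^ 2 * t ^ (n + 1)))
    (by fun_prop) ha, lintegral_haarIoi_ofReal (by fun_prop)]
  refine setLIntegral_congr_fun measurableSet_Ioi fun t (ht : 0 < t) => ?_
  simp only [posPart_of_pos η ht]
  rw [pow_succ t, ← mul_assoc, mul_div_cancel_right₀ _ ht.ne']

theorem lintegral_sq_profile {η : ℝ → ℝ} (hη : IsNormalized η) {a : ℝ} (ha : 0 < a) :
    ∫⁻ t, ENNReal.ofReal (posPart η (t / a) ^ 2) ∂haarIoi = 1 := by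
  have hm := hη.measurable_posPart
  rw [lintegral_haarIoi_div (f := fun t => ENNReal.ofReal (posPart η t ^ 2))
    (by fun_prop) ha, lintegral_haarIoi_ofReal (by fun_prop), ← hη.norm_inv]
  refine setLIntegral_congr_fun measurableSet_Ioi fun t (ht : 0 < t) => ?_
  simp only [posPart_of_pos η ht]

theorem setLIntegral_Ioc_one_div {a b : ℝ} (ha : 0 < a) (hab : a ≤ b) :
    ∫⁻ t in Ioc a b, ENNReal.ofReal (1 / t) = ENNReal.ofReal (log b - log a) := by
  have hb := ha.trans_le hab
  have hI : IntervalIntegrable (fun x : ℝ => 1 / x) volume a b := by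
    refine intervalIntegral.intervalIntegrable_one_div (fun x hx => ?_) continuousOn_id
    rw [uIcc_of_le hab] at hx
    exact (ha.trans_le hx.1).ne'
  rw [← log_div hb.ne' ha.ne', ← integral_one_div_of_pos ha hb,
    intervalIntegral.integral_of_le hab, ofReal_integral_eq_lintegral_ofReal]
  · exact (intervalIntegrable_iff_integrableOn_Ioc_of_le hab).1 hI
  · exact (ae_restrict_iff' measurableSet_Ioc).2 (.of_forall fun x hx =>
      one_div_nonneg.2 (ha.trans hx.1).le)

/-- The energy `∫ η'² t dt` of a profile. -/
noncomputable def profileEnergy (η : ℝ → ℝ) : ℝ≥0∞ :=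
  ∫⁻ t in Ioi (0 : ℝ), ENNReal.ofReal (deriv η t ^ 2 * t)

theorem sq_lintegral_mul_le {α : Type*} [MeasurableSpace α] {μ : Measure α} {f g : α → ℝ≥0∞}
    (hf : AEMeasurable f μ) (hg : AEMeasurable g μ) :
    (∫⁻ x, f x * g x ∂μ) ^ 2 ≤ (∫⁻ x, f x ^ 2 ∂μ) * ∫⁻ x, g x ^ 2 ∂μ := by
  have h := ENNReal.lintegral_mul_le_Lp_mul_Lq μ Real.HolderConjugate.two_two hf hg
  have h2 := pow_le_pow_left' h 2
  rw [mul_pow, ← ENNReal.rpow_natCast, ← ENNReal.rpow_natCast, ← ENNReal.rpow_natCast,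
    ← ENNReal.rpow_mul, ← ENNReal.rpow_mul] at h2
  simpa using h2

/-- Cauchy–Schwarz with `|η'| = t^{-1/2} · t^{1/2}|η'|`, where `∫ dt/t` gives the logarithm. -/
theorem IsNormalized.sq_sub_le {η : ℝ → ℝ} (hη : IsNormalized η) {a b : ℝ} (ha : 0 < a)
    (hab : a ≤ b) :
    ENNReal.ofReal ((η b - η a) ^ 2) ≤ ENNReal.ofReal (log b - log a) *
      ∫⁻ t in Ioc a b, ENNReal.ofReal (deriv η t ^ 2 * t) := by
  rw [← setLIntegral_Ioc_one_div ha hab]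
  have hAC := hη.locallyAC a b ha hab
  have h1 : ENNReal.ofReal ((η b - η a) ^ 2) ≤ (∫⁻ t in Ioc a b, ‖deriv η t‖ₑ) ^ 2 := by
    rw [← hAC.integral_deriv_eq_sub, intervalIntegral.integral_of_le hab, ← sq_abs,
      ENNReal.ofReal_pow (abs_nonneg _), ← Real.norm_eq_abs, ofReal_norm]
    exact pow_le_pow_left' (enorm_integral_le_lintegral_enorm _) 2
  have h2 : ∫⁻ t in Ioc a b, ‖deriv η t‖ₑ = ∫⁻ t in Ioc a b,
      ENNReal.ofReal (√(1 / t)) * ENNReal.ofReal (√(deriv η t ^ 2 * t)) := by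
    refine setLIntegral_congr_fun measurableSet_Ioc fun t ht => ?_
    have ht0 : 0 < t := ha.trans ht.1
    change _ = ENNReal.ofReal (√(1 / t)) * ENNReal.ofReal (√(deriv η t ^ 2 * t))
    rw [← ENNReal.ofReal_mul (sqrt_nonneg _), ← sqrt_mul (by positivity), ← ofReal_norm]
    congr 1
    rw [Real.norm_eq_abs, ← sqrt_sq_eq_abs]
    congr 1
    field_simp
  have hd : Measurable (deriv η) := measurable_deriv η
  refine h1.trans ?_
  rw [h2]
  refine (sq_lintegral_mul_le (by fun_prop) (by fun_prop)).trans (le_of_eq ?_)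
  congr 1 <;> refine setLIntegral_congr_fun measurableSet_Ioc fun t ht => ?_
  all_goals
    have ht0 : 0 < t := ha.trans ht.1
    rw [← ENNReal.ofReal_pow (sqrt_nonneg _), sq_sqrt (by positivity)]

/-- In the variable `log t` dilations are translations, and this is `‖g(· + h) - g‖² ≤ h² ‖g'‖²`.
One factor `log b - log a` comes from Cauchy–Schwarz, the other from Tonelli. -/
theorem lintegral_sq_profile_sub_le {η : ℝ → ℝ} (hη : IsNormalized η) {a b : ℝ} (ha : 0 < a)
    (hb : 0 < b) :
    ∫⁻ t, ENNReal.ofReal ((posPart η (t / a) - posPart η (t / b)) ^ 2) ∂haarIoi ≤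
      ENNReal.ofReal ((log a - log b) ^ 2) * profileEnergy η := by
  wlog hab : a ≤ b generalizing a b
  · have := this hb ha (le_of_not_ge hab)
    rw [← neg_sub, neg_sq]
    convert this using 4
    ring
  have hm := hη.measurable_posPart
  have hd : Measurable (deriv η) := measurable_deriv η
  have hL : 0 ≤ log b - log a := sub_nonneg.2 (log_le_log ha hab)
  rw [lintegral_haarIoi (by fun_prop)]
  set g : ℝ → ℝ≥0∞ := fun s => ENNReal.ofReal (deriv η s ^ 2 * s) with hg
  have hgm : Measurable g := by fun_prop
  have h1 : ∀ t ∈ Ioi (0 : ℝ), ENNReal.ofReal (1 / t) *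
      ENNReal.ofReal ((posPart η (t / a) - posPart η (t / b)) ^ 2) ≤
      ENNReal.ofReal (log b - log a) * (ENNReal.ofReal (1 / t) *
        ∫⁻ s in Ioi 0, {z : ℝ × ℝ | a * z.2 ≤ z.1 ∧ z.1 < b * z.2}.indicator
          (fun z => g z.2) (t, s)) := by
    intro t (ht : 0 < t)
    rw [posPart_of_pos η (by positivity), posPart_of_pos η (by positivity), mul_left_comm]
    gcongr
    have h := hη.sq_sub_le (a := t / b) (b := t / a) (by positivity) (by gcongr)
    have e : log (t / a) - log (t / b) = log b - log a := by
      rw [log_div ht.ne' ha.ne', log_div ht.ne' hb.ne']; ring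
    rw [e] at h
    refine h.trans (le_of_eq ?_)
    congr 1
    have e2 : ∀ s, {z : ℝ × ℝ | a * z.2 ≤ z.1 ∧ z.1 < b * z.2}.indicator
          (fun z => g z.2) (t, s) = (Ioc (t / b) (t / a)).indicator g s := by
      intro s
      simp only [indicator, mem_ofPred_eq, mem_Ioc, div_lt_iff₀ hb, le_div_iff₀ ha]
      congr 1
      rw [and_comm, mul_comm a, mul_comm b]
    simp only [e2]
    rw [lintegral_indicator measurableSet_Ioc, Measure.restrict_restrict measurableSet_Ioc,
      inter_eq_left.2]
    exact fun s hs => lt_trans (by positivity) hs.1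
  have hms : MeasurableSet {z : ℝ × ℝ | a * z.2 ≤ z.1 ∧ z.1 < b * z.2} := by
    have h1 : MeasurableSet {z : ℝ × ℝ | a * z.2 ≤ z.1} :=
      measurableSet_le (by fun_prop) (by fun_prop)
    have h2 : MeasurableSet {z : ℝ × ℝ | z.1 < b * z.2} :=
      measurableSet_lt (by fun_prop) (by fun_prop)
    exact h1.inter h2
  have hF : Measurable fun z : ℝ × ℝ =>
      {z : ℝ × ℝ | a * z.2 ≤ z.1 ∧ z.1 < b * z.2}.indicator (fun z => g z.2) z :=
    (hgm.comp measurable_snd).indicator hms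
  refine (setLIntegral_mono' measurableSet_Ioi h1).trans ?_
  have hF2 : Measurable fun z : ℝ × ℝ => ENNReal.ofReal (1 / z.1) *
      {z : ℝ × ℝ | a * z.2 ≤ z.1 ∧ z.1 < b * z.2}.indicator (fun z => g z.2) z := by
    fun_prop
  rw [lintegral_const_mul']
  swap
  · exact ENNReal.ofReal_ne_top
  have h3 : ∀ t : ℝ, ENNReal.ofReal (1 / t) *
      ∫⁻ s in Ioi 0, {z : ℝ × ℝ | a * z.2 ≤ z.1 ∧ z.1 < b * z.2}.indicator
          (fun z => g z.2) (t, s) = ∫⁻ s in Ioi 0, ENNReal.ofReal (1 / t) *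
      {z : ℝ × ℝ | a * z.2 ≤ z.1 ∧ z.1 < b * z.2}.indicator (fun z => g z.2) (t, s) :=
    fun t => (lintegral_const_mul' _ _ ENNReal.ofReal_ne_top).symm
  simp only [h3]
  have hsq : (log a - log b) ^ 2 = (log b - log a) * (log b - log a) := by ring
  rw [lintegral_lintegral_swap hF2.aemeasurable, hsq,
    ENNReal.ofReal_mul hL, mul_assoc]
  gcongr
  rw [profileEnergy, ← lintegral_const_mul _ hgm]
  refine le_of_eq (setLIntegral_congr_fun measurableSet_Ioi fun s (hs : 0 < s) => ?_)
  -- For fixed `s` the admissible `t` fill `[a s, b s)`, of `dt/t`-measure `log b - log a`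
  -- independently of `s`.
  have h4 : ∀ t, ENNReal.ofReal (1 / t) * {z : ℝ × ℝ | a * z.2 ≤ z.1 ∧ z.1 < b * z.2}.indicator
      (fun z => g z.2) (t, s) =
      (Ico (a * s) (b * s)).indicator (fun t => ENNReal.ofReal (1 / t) * g s) t := by
    intro t
    simp only [indicator, mem_ofPred_eq, mem_Ico, mul_ite, mul_zero]
  simp only [h4]
  have hsub : Ico (a * s) (b * s) ∩ Ioi 0 = Ico (a * s) (b * s) :=
    inter_eq_left.2 fun t ht => (mul_pos ha hs).trans_le ht.1
  rw [lintegral_indicator measurableSet_Ico, Measure.restrict_restrict measurableSet_Ico,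
    hsub, restrict_Ico_eq_restrict_Ioc,
    lintegral_mul_const _ (by fun_prop), setLIntegral_Ioc_one_div (by positivity) (by gcongr),
    log_mul hb.ne' hs.ne', log_mul ha.ne' hs.ne']
  congr 2
  ring

end Profile

/-! ### The localization error for a pair of points -/

section Pointwise

open Real

/-- The geometric mean is at most the logarithmic mean; this follows from `x ≤ sinh x` at half the
logarithm of the ratio. -/
theorem mul_sq_log_sub_log_le {a b : ℝ} (ha : 0 < a) (hb : 0 < b) :
    a * b * (log a - log b) ^ 2 ≤ (a - b) ^ 2 := by
  wlog hab : b ≤ a generalizing a b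
  · have := this hb ha (le_of_not_ge hab)
    linarith [sq_abs (log a - log b)]
  have hx : 0 ≤ log a - log b := sub_nonneg.2 (log_le_log hb hab)
  have h1 := self_le_sinh_iff.2 (div_nonneg hx zero_le_two)
  have hpa : exp ((log a - log b) / 2) = √a / √b := by
    rw [exp_half, exp_sub, exp_log ha, exp_log hb, sqrt_div ha.le]
  have hpb : exp (-((log a - log b) / 2)) = √b / √a := by
    rw [exp_neg, hpa, inv_div]
  rw [sinh_eq, hpa, hpb] at h1
  have hsa := sqrt_pos.2 ha
  have hsb := sqrt_pos.2 hb
  have h2 : √a * √b * (log a - log b) ≤ a - b := by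
    have h3 : √a * √b * ((log a - log b) / 2) ≤ √a * √b * ((√a / √b - √b / √a) / 2) := by gcongr
    have h4 : √a * √b * ((√a / √b - √b / √a) / 2) = (√a ^ 2 - √b ^ 2) / 2 := by
      field_simp
    rw [h4, sq_sqrt ha.le, sq_sqrt hb.le] at h3
    linarith
  have h5 := pow_le_pow_left₀ (by positivity) h2 2
  rwa [mul_pow, mul_pow, sq_sqrt ha.le, sq_sqrt hb.le] at h5

theorem memLp_two_haarIoi {p : ℝ → ℝ} (hp : Measurable p)
    (h : ∫⁻ t, ENNReal.ofReal (p t ^ 2) ∂haarIoi = 1) : Integrable (fun t => p t ^ 2) haarIoi ∧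
      ∫ t, p t ^ 2 ∂haarIoi = 1 := by
  have hi : Integrable (fun t => p t ^ 2) haarIoi := by
    rw [← lintegral_ofReal_ne_top_iff_integrable (by fun_prop) (.of_forall fun t => sq_nonneg _), h]
    exact ENNReal.one_ne_top
  refine ⟨hi, ?_⟩
  rw [← ofReal_integral_eq_lintegral_ofReal hi (.of_forall fun t => sq_nonneg _)] at h
  simpa using h

/-- The localization error: `a` and `b` are local length scales at the points where `U` and `V`
live, and their ratio is controlled by that of the norms. -/
theorem lintegral_norm_sq_smul_sub_smul_le {H : Type*} [NormedAddCommGroup H]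
    [InnerProductSpace ℂ H] {η : ℝ → ℝ} (hη : IsNormalized η) (hN : profileEnergy η ≠ ∞) {c : ℝ}
    (hc : 0 ≤ c) {U V : H} {a b : ℝ} (ha : U ≠ 0 → 0 < a) (hb : V ≠ 0 → 0 < b)
    (hab : U ≠ 0 → V ≠ 0 → (log a - log b) ^ 2 ≤ c * (log ‖U‖ - log ‖V‖) ^ 2) :
    ∫⁻ t, ENNReal.ofReal (‖posPart η (t / a) • U - posPart η (t / b) • V‖ ^ 2) ∂haarIoi ≤
      (1 + ENNReal.ofReal c * profileEnergy η) * ENNReal.ofReal (‖U - V‖ ^ 2) := by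
  have hm := hη.measurable_posPart
  have one_side : ∀ {W : H} {e : ℝ}, (W ≠ 0 → 0 < e) →
      ∫⁻ t, ENNReal.ofReal (‖posPart η (t / e) • W‖ ^ 2) ∂haarIoi = ENNReal.ofReal (‖W‖ ^ 2) := by
    intro W e he
    by_cases hW : W = 0
    · simp [hW]
    · have : ∀ t, ENNReal.ofReal (‖posPart η (t / e) • W‖ ^ 2) =
          ENNReal.ofReal (posPart η (t / e) ^ 2) * ENNReal.ofReal (‖W‖ ^ 2) := by
        intro t
        rw [norm_smul, mul_pow, ENNReal.ofReal_mul (by positivity), Real.norm_eq_abs, sq_abs]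
      simp only [this]
      rw [lintegral_mul_const _ (by fun_prop), lintegral_sq_profile hη (he hW), one_mul]
  -- If one vector vanishes, its scale is unconstrained, and the normalization of `η` alone gives
  -- the bound.
  by_cases hU : U = 0
  · simp only [hU, smul_zero, zero_sub, norm_neg, one_side hb]
    exact le_mul_of_one_le_left' le_self_add
  by_cases hV : V = 0
  · simp only [hV, smul_zero, sub_zero, one_side ha]
    exact le_mul_of_one_le_left' le_self_add
  have ha := ha hU
  have hb := hb hV
  have hab := hab hU hV
  set p : ℝ → ℝ := fun t => posPart η (t / a) with hp
  set q : ℝ → ℝ := fun t => posPart η (t / b) with hq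
  have hpm : Measurable p := by fun_prop
  have hqm : Measurable q := by fun_prop
  obtain ⟨hpi, hp1⟩ := memLp_two_haarIoi hpm (lintegral_sq_profile hη ha)
  obtain ⟨hqi, hq1⟩ := memLp_two_haarIoi hqm (lintegral_sq_profile hη hb)
  have hN' := lintegral_sq_profile_sub_le hη ha hb
  have hdi : Integrable (fun t => (p t - q t) ^ 2) haarIoi := by
    rw [← lintegral_ofReal_ne_top_iff_integrable (by fun_prop) (.of_forall fun t => sq_nonneg _)]
    exact ne_top_of_le_ne_top (ENNReal.mul_ne_top ENNReal.ofReal_ne_top hN) hN'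
  set N := (profileEnergy η).toReal with hNdef
  have hNe : profileEnergy η = ENNReal.ofReal N := (ENNReal.ofReal_toReal hN).symm
  have hN0 : 0 ≤ N := ENNReal.toReal_nonneg
  have hd : ∫ t, (p t - q t) ^ 2 ∂haarIoi ≤ (log a - log b) ^ 2 * N := by
    rw [← ofReal_integral_eq_lintegral_ofReal hdi (.of_forall fun t => sq_nonneg _), hNe,
      ← ENNReal.ofReal_mul (sq_nonneg _)] at hN'
    exact (ENNReal.ofReal_le_ofReal_iff (by positivity)).1 hN'
  set R := (⟪U, V⟫_ℂ).re with hR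
  have hRle : R ≤ ‖U‖ * ‖V‖ := (Complex.re_le_norm _).trans (norm_inner_le_norm U V)
  have hns : ∀ x y : ℝ, ‖x • U - y • V‖ ^ 2 = x ^ 2 * ‖U‖ ^ 2 - 2 * (x * y * R) + y ^ 2 * ‖V‖ ^ 2 := by
    intro x y
    have := norm_sub_sq (𝕜 := ℂ) (x • U) (y • V)
    rw [this, norm_smul, norm_smul, mul_pow, mul_pow, Real.norm_eq_abs, Real.norm_eq_abs, sq_abs,
      sq_abs, inner_smul_left_eq_smul, inner_smul_right_eq_smul]
    simp [hR, mul_assoc]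
  have hUV : ‖U - V‖ ^ 2 = ‖U‖ ^ 2 - 2 * R + ‖V‖ ^ 2 := by
    have := hns 1 1
    simpa using this
  -- A discrete IMS formula: as `∫ p² = ∫ q² = 1`, the first two terms integrate to `‖U - V‖²`, and
  -- the third is the localization error.
  have hexp : ∀ t, ‖p t • U - q t • V‖ ^ 2 =
      (‖U‖ ^ 2 - R) * p t ^ 2 + (‖V‖ ^ 2 - R) * q t ^ 2 + R * (p t - q t) ^ 2 := by
    intro t
    rw [hns]
    ring
  have hi1 := (hpi.const_mul (‖U‖ ^ 2 - R)).add (hqi.const_mul (‖V‖ ^ 2 - R))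
  have hi2 := hdi.const_mul R
  have hint : ∫ t, ‖p t • U - q t • V‖ ^ 2 ∂haarIoi =
      ‖U - V‖ ^ 2 + R * ∫ t, (p t - q t) ^ 2 ∂haarIoi := by
    simp only [hexp]
    rw [integral_add (by exact hi1) hi2, integral_add (hpi.const_mul _) (hqi.const_mul _),
      integral_const_mul, integral_const_mul, integral_const_mul, hp1, hq1, hUV]
    ring
  have hi : Integrable (fun t => ‖p t • U - q t • V‖ ^ 2) haarIoi := by
    simp only [hexp]
    exact hi1.add hi2
  -- Discrete form of `∫ |∇√ρ|² ≤ ∑ ∫ |∇uᵢ|²`: the factor `‖U‖ ‖V‖` turns the squared difference of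
  -- logarithms into `(‖U‖ - ‖V‖)²`.
  have hbound : R * ∫ t, (p t - q t) ^ 2 ∂haarIoi ≤ c * N * ‖U - V‖ ^ 2 := by
    have hd0 : 0 ≤ ∫ t, (p t - q t) ^ 2 ∂haarIoi := integral_nonneg fun t => sq_nonneg _
    have hU0 : 0 < ‖U‖ := norm_pos_iff.2 hU
    have hV0 : 0 < ‖V‖ := norm_pos_iff.2 hV
    have hlog := mul_sq_log_sub_log_le hU0 hV0
    have htri : (‖U‖ - ‖V‖) ^ 2 ≤ ‖U - V‖ ^ 2 :=
      sq_le_sq' (by linarith [norm_sub_norm_le V U, norm_sub_rev U V]) (norm_sub_norm_le U V)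
    calc R * ∫ t, (p t - q t) ^ 2 ∂haarIoi
        ≤ ‖U‖ * ‖V‖ * ∫ t, (p t - q t) ^ 2 ∂haarIoi := by gcongr
      _ ≤ ‖U‖ * ‖V‖ * (c * (log ‖U‖ - log ‖V‖) ^ 2 * N) := by
          gcongr
          exact hd.trans (by gcongr)
      _ = c * N * (‖U‖ * ‖V‖ * (log ‖U‖ - log ‖V‖) ^ 2) := by ring
      _ ≤ c * N * ‖U - V‖ ^ 2 := by gcongr; exact hlog.trans htri
  rw [← ofReal_integral_eq_lintegral_ofReal hi (.of_forall fun t => sq_nonneg _), hint, hNe,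
    ← ENNReal.ofReal_mul hc, ← ENNReal.ofReal_one, ← ENNReal.ofReal_add zero_le_one (by positivity),
    ← ENNReal.ofReal_mul (by positivity)]
  exact ENNReal.ofReal_le_ofReal (by linarith)

end Pointwise

/-! ### Momentum density of a localized Bessel family -/

section PhaseSpace

open FourierTransform Real

variable {E : Type*} [NormedAddCommGroup E] [InnerProductSpace ℝ E] [FiniteDimensional ℝ E]
  [MeasurableSpace E] [BorelSpace E]

theorem memLp_two_iff_lintegral_enorm_sq {α F : Type*} [MeasurableSpace α] [NormedAddCommGroup F]
    {μ : Measure α} {f : α → F} (hf : AEStronglyMeasurable f μ) :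
    MemLp f 2 μ ↔ ∫⁻ x, ‖f x‖ₑ ^ 2 ∂μ < ∞ := by
  have := eLpNorm_nnreal_pow_eq_lintegral (μ := μ) (f := f) (p := 2) two_ne_zero
  simp only [NNReal.coe_ofNat, ENNReal.rpow_ofNat, ENNReal.coe_ofNat] at this
  rw [← this, MemLp, and_iff_right hf]
  simp

/-- The coherent-state type bound on the momentum density of a localized Bessel family. -/
theorem sum_enorm_sq_fourier_le {ι : Type*} [Fintype ι] {u : ι → Lp ℂ 2 (volume : Measure E)}
    (hu : ∀ φ : Lp ℂ 2 (volume : Measure E), ∑ i, ‖⟪u i, φ⟫_ℂ‖ ^ 2 ≤ ‖φ‖ ^ 2) {χ : E → ℝ}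
    (hχ : MemLp χ 2) (hχu : ∀ i, MemLp (fun x => χ x • u i x) 2) :
    ∀ᵐ p, ∑ i, ‖fourierLp (hχu i).toLp p‖ₑ ^ 2 ≤ ∫⁻ x, ‖χ x‖ₑ ^ 2 := by
  have h1 : ∀ i, Integrable (fun x => χ x • u i x) := fun i =>
    memLp_one_iff_integrable.1 ((Lp.memLp (u i)).smul hχ)
  have h2 : ∀ᵐ p, ∀ i, 𝓕 (fun x => χ x • u i x) p = fourierLp (hχu i).toLp p :=
    ae_all_iff.2 fun i => fourier_Lp_of_integrable (hχu i) (h1 i)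
  filter_upwards [h2] with p hp
  -- The transform of `χ uᵢ` at `p` is the inner product of `uᵢ` with this coherent state, of
  -- squared norm `∫ χ²`.
  set f : E → ℂ := fun x => ((Real.fourierChar ⟪x, p⟫_ℝ : Circle) : ℂ) * (χ x : ℂ) with hf
  have hfm : AEStronglyMeasurable f := by
    refine AEStronglyMeasurable.mul ?_ (Complex.continuous_ofReal.comp_aestronglyMeasurable hχ.1)
    refine Continuous.aestronglyMeasurable ?_
    simp only [Real.fourierChar_apply]
    fun_prop
  have hfn : ∀ x, ‖f x‖ = ‖χ x‖ := by
    intro x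
    rw [hf, norm_mul, Circle.norm_coe, one_mul, Complex.norm_real]
  have hfL : MemLp f 2 := hχ.of_le hfm (.of_forall fun x => (hfn x).le)
  have hin : ∀ i, ⟪hfL.toLp, u i⟫_ℂ = fourierLp (hχu i).toLp p := by
    intro i
    rw [← hp i, L2.inner_def, Real.fourier_eq]
    refine integral_congr_ae ?_
    filter_upwards [hfL.coeFn_toLp] with x hx
    rw [hx, hf, RCLike.inner_apply, map_mul, ← Circle.coe_inv_eq_conj, ← AddChar.map_neg_eq_inv,
      Circle.smul_def, Complex.conj_ofReal, Complex.real_smul, smul_eq_mul]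
    ring
  have h3 := hu hfL.toLp
  have h4 : ENNReal.ofReal (‖hfL.toLp‖ ^ 2) = ∫⁻ x, ‖χ x‖ₑ ^ 2 := by
    rw [← lintegral_enorm_sq_Lp]
    refine lintegral_congr_ae ?_
    filter_upwards [hfL.coeFn_toLp] with x hx
    rw [hx, ← ofReal_norm, hfn, ofReal_norm]
  rw [← h4]
  refine le_trans (le_of_eq ?_) (ENNReal.ofReal_le_ofReal h3)
  rw [ENNReal.ofReal_sum_of_nonneg fun i _ => by positivity]
  refine Finset.sum_congr rfl fun i _ => ?_
  rw [← hin, ENNReal.ofReal_pow (norm_nonneg _), ← ofReal_norm, norm_inner_symm]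

/-- Bathtub argument: Plancherel gives the total mass of the momentum density, and where `a` falls
short of `e` the deficit is at most `w` times the pointwise bound on that density. -/
theorem phase_space_bound {ι : Type*} [Fintype ι] {u : ι → Lp ℂ 2 (volume : Measure E)}
    (hu : ∀ φ : Lp ℂ 2 (volume : Measure E), ∑ i, ‖⟪u i, φ⟫_ℂ‖ ^ 2 ≤ ‖φ‖ ^ 2) {χ : E → ℝ}
    (hχ : MemLp χ 2) (hχu : ∀ i, MemLp (fun x => χ x • u i x) 2) {a w : E → ℝ≥0∞} {e : ℝ≥0∞}
    (ha : Measurable a) (hw : Measurable w) (he : ∀ p, e ≤ a p + w p) :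
    e * ∫⁻ x, ‖χ x‖ₑ ^ 2 * ∑ i, ‖u i x‖ₑ ^ 2 ≤
      (∑ i, ∫⁻ p, a p * ‖fourierLp (hχu i).toLp p‖ₑ ^ 2) + (∫⁻ p, w p) * ∫⁻ x, ‖χ x‖ₑ ^ 2 := by
  have hm : ∀ i, Measurable fun p => ‖fourierLp (hχu i).toLp p‖ₑ ^ 2 := fun i =>
    (Lp.stronglyMeasurable _).measurable.enorm.pow_const 2
  have hS : Measurable fun p => ∑ i, ‖fourierLp (hχu i).toLp p‖ₑ ^ 2 :=
    Finset.measurable_sum _ fun i _ => hm i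
  have hx : ∫⁻ x, ‖χ x‖ₑ ^ 2 * ∑ i, ‖u i x‖ₑ ^ 2 =
      ∫⁻ p, ∑ i, ‖fourierLp (hχu i).toLp p‖ₑ ^ 2 := by
    rw [lintegral_finsetSum _ fun i _ => hm i]
    simp only [lintegral_enorm_sq_fourier]
    have : ∀ i, ∫⁻ x, ‖(hχu i).toLp _ x‖ₑ ^ 2 = ∫⁻ x, ‖χ x‖ₑ ^ 2 * ‖u i x‖ₑ ^ 2 := by
      intro i
      refine lintegral_congr_ae ?_
      filter_upwards [(hχu i).coeFn_toLp] with x hx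
      rw [hx, enorm_smul, mul_pow]
    simp only [this, Finset.mul_sum]
    refine lintegral_finsetSum' _ fun i _ => ?_
    exact (hχ.1.enorm.pow_const 2).mul ((Lp.aestronglyMeasurable (u i)).enorm.pow_const 2)
  have ham : ∀ i, Measurable fun p => a p * ‖fourierLp (hχu i).toLp p‖ₑ ^ 2 := fun i =>
    ha.mul (hm i)
  rw [hx, ← lintegral_const_mul _ hS, ← lintegral_finsetSum _ fun i _ => ham i,
    ← lintegral_mul_const _ hw, ← lintegral_add_right _ (hw.mul_const _)]
  refine lintegral_mono_ae ?_
  filter_upwards [sum_enorm_sq_fourier_le hu hχ hχu] with p hp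
  rw [← Finset.mul_sum]
  calc _ ≤ (a p + w p) * ∑ i, ‖fourierLp (hχu i).toLp p‖ₑ ^ 2 := by gcongr; exact he p
    _ ≤ _ := by rw [add_mul]; gcongr

/-- The semiclassical phase space volume `∫ (1 - 4π²|p|²)₊ dp`. -/
noncomputable def phaseSpaceConst (E : Type*) [NormedAddCommGroup E] [MeasureSpace E] : ℝ≥0∞ :=
  ∫⁻ p : E, ENNReal.ofReal (1 - 4 * π ^ 2 * ‖p‖ ^ 2)

theorem lintegral_sub_sq {t : ℝ} (ht : 0 < t) :
    ∫⁻ p : E, ENNReal.ofReal (t ^ 2 - 4 * π ^ 2 * ‖p‖ ^ 2) =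
      ENNReal.ofReal (t ^ (Module.finrank ℝ E + 2)) * phaseSpaceConst E := by
  have h := Measure.map_addHaar_smul (volume : Measure E) (inv_ne_zero ht.ne')
  have h1 : ∀ p : E, ENNReal.ofReal (t ^ 2 - 4 * π ^ 2 * ‖p‖ ^ 2) =
      ENNReal.ofReal (t ^ 2) * ENNReal.ofReal (1 - 4 * π ^ 2 * ‖t⁻¹ • p‖ ^ 2) := by
    intro p
    rw [← ENNReal.ofReal_mul (by positivity), norm_smul, norm_inv, Real.norm_of_nonneg ht.le]
    congr 1
    field_simp
  have hm : Measurable fun p : E => ENNReal.ofReal (1 - 4 * π ^ 2 * ‖p‖ ^ 2) := by fun_prop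
  simp only [h1]
  rw [lintegral_const_mul _ (by fun_prop),
    ← lintegral_map (f := fun p : E => ENNReal.ofReal (1 - 4 * π ^ 2 * ‖p‖ ^ 2))
      (g := fun p : E => t⁻¹ • p) hm (by fun_prop), h, lintegral_smul_measure, phaseSpaceConst,
    smul_eq_mul, ← mul_assoc, ← ENNReal.ofReal_mul (by positivity), inv_pow, inv_inv,
    abs_of_pos (by positivity), ← pow_add, add_comm]

theorem lintegral_Ioi_sqrt_one_sub_pow {d : ℕ} (hd : 1 ≤ d) :
    ∫⁻ s in Ioi (0 : ℝ), ENNReal.ofReal (√(1 - s)) ^ d = ENNReal.ofReal (2 / (d + 2)) := by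
  have h1 : ∀ s, ENNReal.ofReal (√(1 - s)) ^ d =
      (Iic (1 : ℝ)).indicator (fun s => ENNReal.ofReal ((1 - s) ^ (d / 2 : ℝ))) s := by
    intro s
    rw [← ENNReal.ofReal_pow (sqrt_nonneg _)]
    by_cases hs : s ≤ 1
    · rw [indicator_of_mem (mem_Iic.2 hs), sqrt_eq_rpow, ← rpow_natCast, ← rpow_mul (by linarith)]
      congr 2
      ring
    · rw [indicator_of_notMem (by simpa using hs), sqrt_eq_zero_of_nonpos (by linarith),
        zero_pow (by lia), ENNReal.ofReal_zero]
  have hd0 : (0 : ℝ) ≤ d / 2 := by positivity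
  have hc : Continuous fun s : ℝ => (1 - s) ^ (d / 2 : ℝ) :=
    (continuous_const.sub continuous_id).rpow_const fun _ => Or.inr hd0
  simp only [h1]
  rw [lintegral_indicator measurableSet_Iic, Measure.restrict_restrict measurableSet_Iic,
    inter_comm, Ioi_inter_Iic, ← ofReal_integral_eq_lintegral_ofReal,
    ← intervalIntegral.integral_of_le zero_le_one,
    intervalIntegral.integral_comp_sub_left (fun s => s ^ (d / 2 : ℝ)) 1,
    integral_rpow (Or.inl (by linarith))]
  · congr 1
    have : (d / 2 + 1 : ℝ) ≠ 0 := by positivity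
    simp [this]
    field_simp
  · exact (hc.integrableOn_Icc).mono_set Ioc_subset_Icc_self
  · exact (ae_restrict_iff' measurableSet_Ioc).2 (.of_forall fun s hs =>
      rpow_nonneg (by linarith [hs.2]) _)

/-- Layer-cake formula: the superlevel sets are balls of radius `√(1 - s) / (2π)`. -/
theorem phaseSpaceConst_eq {d : ℕ} (hd : 1 ≤ d) : phaseSpaceConst (Space d) =
    ENNReal.ofReal (2 / (d + 2) * (1 / (2 * π)) ^ d * (√π ^ d / Gamma (d / 2 + 1))) := by
  have : Nonempty (Fin d) := ⟨⟨0, hd⟩⟩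
  have h1 : phaseSpaceConst (Space d) =
      ∫⁻ p : Space d, ENNReal.ofReal (max (1 - 4 * π ^ 2 * ‖p‖ ^ 2) 0) := by
    simp [phaseSpaceConst]
  have h2 : ∀ s ∈ Ioi (0 : ℝ), volume {p : Space d | s < max (1 - 4 * π ^ 2 * ‖p‖ ^ 2) 0} =
      ENNReal.ofReal (√(1 - s)) ^ d * ENNReal.ofReal ((1 / (2 * π)) ^ d *
        (√π ^ d / Gamma (d / 2 + 1))) := by
    intro s (hs : 0 < s)
    have h3 : {p : Space d | s < max (1 - 4 * π ^ 2 * ‖p‖ ^ 2) 0} =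
        Metric.ball 0 (√(1 - s) * (1 / (2 * π))) := by
      ext p
      rw [mem_ball_zero_iff, mul_one_div, lt_div_iff₀ (by positivity),
        lt_sqrt (by positivity), mem_ofPred_eq, lt_max_iff]
      constructor
      · rintro (h | h)
        · linarith
        · linarith
      · intro h
        left
        linarith
    rw [h3, EuclideanSpace.volume_ball, Fintype.card_fin, ENNReal.ofReal_mul (sqrt_nonneg _),
      mul_pow, ENNReal.ofReal_mul (by positivity), ENNReal.ofReal_pow (by positivity), mul_assoc]
  rw [h1, lintegral_eq_lintegral_meas_lt (f := fun p : Space d => max (1 - 4 * π ^ 2 * ‖p‖ ^ 2) 0)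
      _ (.of_forall fun p => le_max_right _ _) (by fun_prop),
    setLIntegral_congr_fun measurableSet_Ioi h2, lintegral_mul_const _ (by fun_prop),
    lintegral_Ioi_sqrt_one_sub_pow hd, ← ENNReal.ofReal_mul (by positivity), mul_assoc]

end PhaseSpace

/-! ### Localization at a position-dependent momentum scale -/

section Localization

open FourierTransform Real

variable {E : Type*} [NormedAddCommGroup E] [InnerProductSpace ℝ E] [FiniteDimensional ℝ E]
  [MeasurableSpace E] [BorelSpace E] {ι : Type*} [Fintype ι]

theorem lintegral_le_of_tendsto {α : Type*} [MeasurableSpace α] {μ : Measure α}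
    {F : ℕ → α → ℝ≥0∞} {G : α → ℝ≥0∞} {C : ℝ≥0∞} (hF : ∀ n, AEMeasurable (F n) μ)
    (hFG : ∀ᵐ x ∂μ, Filter.Tendsto (fun n => F n x) Filter.atTop (nhds (G x)))
    (hC : ∀ n, ∫⁻ x, F n x ∂μ ≤ C) : ∫⁻ x, G x ∂μ ≤ C := by
  calc ∫⁻ x, G x ∂μ = ∫⁻ x, Filter.liminf (fun n => F n x) Filter.atTop ∂μ :=
        lintegral_congr_ae (hFG.mono fun x hx => hx.liminf_eq.symm)
    _ ≤ Filter.liminf (fun n => ∫⁻ x, F n x ∂μ) Filter.atTop := lintegral_liminf_le' hF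
    _ ≤ Filter.liminf (fun _ : ℕ => C) Filter.atTop :=
        Filter.liminf_le_liminf (.of_forall hC)
    _ = C := Filter.liminf_const C

/-- The density `∑ |uᵢ|²` of a finite family. -/
noncomputable def familyDensity (u : ι → Lp ℂ 2 (volume : Measure E)) (x : E) : ℝ := ∑ i, ‖u i x‖ ^ 2

theorem measurable_familyDensity (u : ι → Lp ℂ 2 (volume : Measure E)) : Measurable (familyDensity u) :=
  Finset.measurable_sum _ fun i _ => (Lp.stronglyMeasurable (u i)).measurable.norm.pow_const 2

theorem familyDensity_nonneg (u : ι → Lp ℂ 2 (volume : Measure E)) (x : E) : 0 ≤ familyDensity u x :=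
  Finset.sum_nonneg fun _ _ => by positivity

theorem ofReal_familyDensity (u : ι → Lp ℂ 2 (volume : Measure E)) (x : E) :
    ENNReal.ofReal (familyDensity u x) = ∑ i, ‖u i x‖ₑ ^ 2 := by
  rw [familyDensity, ENNReal.ofReal_sum_of_nonneg fun i _ => by positivity]
  refine Finset.sum_congr rfl fun i _ => ?_
  rw [ENNReal.ofReal_pow (norm_nonneg _), ofReal_norm]

/-- `f` is a local momentum scale for the density `ρ`: it is positive exactly where `ρ` is, and its
logarithm varies at most `1 / d` times as much as that of `ρ`. -/
structure IsMomentumScale (d : ℕ) (ρ f : E → ℝ) : Prop where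
  measurable : Measurable f
  pos : ∀ x, ρ x ≠ 0 → 0 < f x
  zero : ∀ x, ρ x = 0 → f x = 0
  sq_log_sub_le : ∀ x y, ρ x ≠ 0 → ρ y ≠ 0 →
    (log (f x) - log (f y)) ^ 2 ≤ 1 / (d : ℝ) ^ 2 * (log (ρ x) - log (ρ y)) ^ 2

theorem sum_enorm_sq_sub_eq (v w : EuclideanSpace ℂ ι) :
    ∑ i, ‖v i - w i‖ₑ ^ 2 = ENNReal.ofReal (‖v - w‖ ^ 2) := by
  rw [EuclideanSpace.norm_sq_eq, ENNReal.ofReal_sum_of_nonneg fun i _ => by positivity]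
  refine Finset.sum_congr rfl fun i _ => ?_
  rw [ENNReal.ofReal_pow (norm_nonneg _), ofReal_norm]
  rfl

/-- The pair estimate for the vectors `(uᵢ(x))ᵢ`, of norm `√ρ(x)`; the square root turns `1 / d²`
into `4 / d²`. -/
theorem lintegral_sum_enorm_sq_localized_le {d : ℕ} {η : ℝ → ℝ} (hη : IsNormalized η)
    (hN : profileEnergy η ≠ ∞) {u : ι → Lp ℂ 2 (volume : Measure E)} {f : E → ℝ}
    (hf : IsMomentumScale d (familyDensity u) f) (x y : E) :
    ∫⁻ t, ∑ i, ‖posPart η (t / f x) • u i x - posPart η (t / f y) • u i y‖ₑ ^ 2 ∂haarIoi ≤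
      (1 + ENNReal.ofReal (4 / (d : ℝ) ^ 2) * profileEnergy η) * ∑ i, ‖u i x - u i y‖ₑ ^ 2 := by
  set U : E → EuclideanSpace ℂ ι := fun x => WithLp.toLp 2 fun i => u i x with hU
  have hUn : ∀ x, ‖U x‖ ^ 2 = familyDensity u x := fun x => EuclideanSpace.norm_sq_eq _
  have hUz : ∀ x, U x ≠ 0 → familyDensity u x ≠ 0 := by
    intro x hx
    rw [← hUn]
    simpa using hx
  have hlog : ∀ x, log (familyDensity u x) = 2 * log ‖U x‖ := by
    intro x
    rw [← hUn, log_pow]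
    norm_num
  have h := lintegral_norm_sq_smul_sub_smul_le hη hN (c := 4 / (d : ℝ) ^ 2) (by positivity)
    (U := U x) (V := U y) (a := f x) (b := f y) (fun h => hf.pos x (hUz x h))
    (fun h => hf.pos y (hUz y h)) (fun h h' => by
      refine (hf.sq_log_sub_le x y (hUz x h) (hUz y h')).trans (le_of_eq ?_)
      rw [hlog, hlog]
      ring)
  rw [← sum_enorm_sq_sub_eq (U x) (U y)] at h
  refine le_trans (le_of_eq (lintegral_congr fun t => ?_)) h
  rw [← sum_enorm_sq_sub_eq]
  simp [hU]

theorem sum_lintegral_mul_lintegral {α β : Type*} [MeasurableSpace α] [MeasurableSpace β]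
    {μ : Measure α} {ν : Measure β} [SFinite ν] {G : α → ℝ≥0∞} {k : ι → α → β → ℝ≥0∞}
    (hG : Measurable G) (hk : ∀ i, Measurable (Function.uncurry (k i))) :
    ∑ i, ∫⁻ h, G h * ∫⁻ x, k i h x ∂ν ∂μ = ∫⁻ h, G h * ∫⁻ x, ∑ i, k i h x ∂ν ∂μ := by
  have h1 : ∀ i, Measurable fun h => G h * ∫⁻ x, k i h x ∂ν := fun i =>
    hG.mul (hk i).lintegral_prod_right'
  have h2 : ∀ i h, Measurable fun x => k i h x := fun i h => (hk i).comp measurable_prodMk_left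
  rw [← lintegral_finsetSum _ fun i _ => h1 i]
  refine lintegral_congr fun h => ?_
  rw [← Finset.mul_sum, lintegral_finsetSum _ fun i _ => h2 i h]

theorem sum_heatEnergy {v : ι → E → ℂ} (hv : ∀ i, Measurable (v i)) (b : ℝ) :
    ∑ i, heatEnergy b (v i) = ∫⁻ h, ENNReal.ofReal (heatKernel b h) *
      ∫⁻ x, ∑ i, ‖v i (x + h) - v i x‖ₑ ^ 2 := by
  have hk : ∀ i, Measurable (Function.uncurry fun h x : E => ‖v i (x + h) - v i x‖ₑ ^ 2) := by
    intro i
    have h1 : Measurable fun z : E × E => v i (z.2 + z.1) :=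
      (hv i).comp (measurable_snd.add measurable_fst)
    have h2 : Measurable fun z : E × E => v i z.2 := (hv i).comp measurable_snd
    exact (h1.sub h2).enorm.pow_const 2
  exact sum_lintegral_mul_lintegral (continuous_heatKernel b).measurable.ennreal_ofReal hk

theorem measurable_localized {η : ℝ → ℝ} (hη : IsNormalized η) {f : E → ℝ} (hf : Measurable f)
    (u : Lp ℂ 2 (volume : Measure E)) : Measurable fun z : ℝ × E => posPart η (z.1 / f z.2) • u z.2 := by
  have h1 := hη.measurable_posPart
  have h2 := (Lp.stronglyMeasurable u).measurable
  fun_prop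

/-- The Gaussian kernel is nonnegative, so by Tonelli the estimate for the pair `x + h`, `x` can be
integrated. -/
theorem lintegral_sum_heatEnergy_localized_le {d : ℕ} {η : ℝ → ℝ} (hη : IsNormalized η)
    (hN : profileEnergy η ≠ ∞) {u : ι → Lp ℂ 2 (volume : Measure E)} {f : E → ℝ}
    (hf : IsMomentumScale d (familyDensity u) f) (b : ℝ) :
    ∫⁻ t, ∑ i, heatEnergy b (fun x => posPart η (t / f x) • u i x) ∂haarIoi ≤
      (1 + ENNReal.ofReal (4 / (d : ℝ) ^ 2) * profileEnergy η) *
        ∑ i, heatEnergy b (u i) := by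
  have hm := fun i => measurable_localized hη hf.measurable (u i)
  have hG : Measurable fun h : E => ENNReal.ofReal (heatKernel b h) :=
    (continuous_heatKernel b).measurable.ennreal_ofReal
  have hmt : ∀ t i, Measurable fun x => posPart η (t / f x) • u i x := fun t i =>
    (hm i).comp measurable_prodMk_left
  set D : ℝ → E → E → ℝ≥0∞ := fun t h x =>
    ∑ i, ‖posPart η (t / f (x + h)) • u i (x + h) - posPart η (t / f x) • u i x‖ₑ ^ 2 with hD
  have hDm : Measurable fun z : (ℝ × E) × E => D z.1.1 z.1.2 z.2 := by
    refine Finset.measurable_sum _ fun i _ => ?_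
    have h1 : Measurable fun z : (ℝ × E) × E =>
        posPart η (z.1.1 / f (z.2 + z.1.2)) • u i (z.2 + z.1.2) :=
      (hm i).comp (f := fun z : (ℝ × E) × E => (z.1.1, z.2 + z.1.2)) (by fun_prop)
    have h2 : Measurable fun z : (ℝ × E) × E => posPart η (z.1.1 / f z.2) • u i z.2 :=
      (hm i).comp (f := fun z : (ℝ × E) × E => (z.1.1, z.2)) (by fun_prop)
    exact (h1.sub h2).enorm.pow_const 2
  have hDm2 : Measurable fun z : ℝ × E => ∫⁻ x, D z.1 z.2 x := hDm.lintegral_prod_right'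
  have hDm3 : ∀ h, Measurable fun z : ℝ × E => D z.1 h z.2 := fun h =>
    hDm.comp (f := fun z : ℝ × E => ((z.1, h), z.2)) (by fun_prop)
  simp only [fun t => sum_heatEnergy (hmt t) b]
  rw [sum_heatEnergy (fun i => (Lp.stronglyMeasurable (u i)).measurable),
    lintegral_lintegral_swap ((hG.comp measurable_snd).mul hDm2).aemeasurable,
    ← lintegral_const_mul']
  swap
  · exact ENNReal.add_ne_top.2 ⟨ENNReal.one_ne_top, ENNReal.mul_ne_top ENNReal.ofReal_ne_top hN⟩
  refine lintegral_mono fun h => ?_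
  have hDm4 : Measurable fun t => ∫⁻ x, D t h x :=
    hDm2.comp (f := fun t : ℝ => (t, h)) (by fun_prop)
  change ∫⁻ t, ENNReal.ofReal (heatKernel b h) * (∫⁻ x, D t h x) ∂haarIoi ≤ _
  rw [lintegral_const_mul _ hDm4, mul_left_comm]
  gcongr
  rw [lintegral_lintegral_swap (hDm3 h).aemeasurable, ← lintegral_const_mul']
  swap
  · exact ENNReal.add_ne_top.2 ⟨ENNReal.one_ne_top, ENNReal.mul_ne_top ENNReal.ofReal_ne_top hN⟩
  exact lintegral_mono fun x => lintegral_sum_enorm_sq_localized_le hη hN hf (x + h) x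

/-- The kinetic energy `∑ ∫ |∇uᵢ|²` of a finite family, in terms of Fourier transforms. -/
noncomputable def familyKinetic (u : ι → Lp ℂ 2 (volume : Measure E)) : ℝ≥0∞ :=
  ∑ i, ∫⁻ p, ENNReal.ofReal (4 * π ^ 2 * ‖p‖ ^ 2) * ‖fourierLp (u i) p‖ₑ ^ 2

theorem sum_heatEnergy_le_familyKinetic (u : ι → Lp ℂ 2 (volume : Measure E)) {b : ℝ} (hb : 0 < b) :
    ∑ i, heatEnergy b (u i) ≤ familyKinetic u := by
  refine Finset.sum_le_sum fun i _ => ?_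
  rw [heatEnergy_eq hb (Lp.memLp (u i)), Lp.toLp_coeFn]
  gcongr with p
  exact expSymbol_le (by positivity) (by positivity)

theorem ae_haarIoi_pos : ∀ᵐ t ∂haarIoi, 0 < t := by
  refine (withDensity_absolutelyContinuous _ _).ae_le ?_
  exact ae_restrict_mem measurableSet_Ioi

theorem ofReal_eq_enorm_sq (x : ℝ) : ENNReal.ofReal (x ^ 2) = ‖x‖ₑ ^ 2 := by
  rw [← sq_abs, ENNReal.ofReal_pow (abs_nonneg _), ← Real.norm_eq_abs, ofReal_norm]

/-- Tonelli and the substitution `t = f(x) s`. -/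
theorem lintegral_pow_mul_lintegral_profile {ρ : E → ℝ} {d n : ℕ} {η : ℝ → ℝ} (hη : IsNormalized η)
    {f : E → ℝ} (hf : IsMomentumScale d ρ f) {w : E → ℝ≥0∞} (hw : Measurable w) :
    ∫⁻ t, ENNReal.ofReal (t ^ (n + 1)) * (∫⁻ x, ‖posPart η (t / f x)‖ₑ ^ 2 * w x) ∂haarIoi =
      (∫⁻ t in Ioi (0 : ℝ), ENNReal.ofReal (η t ^ 2 * t ^ n)) *
        ∫⁻ x, ENNReal.ofReal (f x ^ (n + 1)) * w x := by
  have h1 := hη.measurable_posPart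
  have h2 := hf.measurable
  have hm : Measurable fun z : ℝ × E => ‖posPart η (z.1 / f z.2)‖ₑ ^ 2 := by fun_prop
  have h3 := lintegral_mul_lintegral_mul (μ := haarIoi) (ν := (volume : Measure E))
    (G := fun t => ENNReal.ofReal (t ^ (n + 1))) (k := fun t x => ‖posPart η (t / f x)‖ₑ ^ 2)
    (by fun_prop) hm hw
  rw [h3, ← lintegral_const_mul _ (by fun_prop)]
  refine lintegral_congr fun x => ?_
  rw [← mul_assoc]
  congr 1
  -- Here `f x = 0`, so `t / f x = 0`, where the extended profile vanishes; both sides are `0`.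
  by_cases hx : ρ x = 0
  · simp [hf.zero x hx, posPart_zero]
  · rw [mul_comm (lintegral _ _), ← lintegral_sq_mul_pow hη (hf.pos x hx)]
    refine lintegral_congr_ae ?_
    filter_upwards [ae_haarIoi_pos] with t ht
    rw [ENNReal.ofReal_mul (sq_nonneg _), ofReal_eq_enorm_sq, mul_comm]

end Localization

/-! ### Integration over the scales `t` for a finite Bessel family -/

section Family

open FourierTransform Real

variable {E : Type*} [NormedAddCommGroup E] [InnerProductSpace ℝ E] [FiniteDimensional ℝ E]
  [MeasurableSpace E] [BorelSpace E] {ι : Type*} [Fintype ι]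

theorem lintegral_localized_le {u : ι → Lp ℂ 2 (volume : Measure E)}
    (hu : ∀ φ : Lp ℂ 2 (volume : Measure E), ∑ i, ‖⟪u i, φ⟫_ℂ‖ ^ 2 ≤ ‖φ‖ ^ 2)
    {χ : E → ℝ} (hχ : MemLp χ 2) (hχu : ∀ i, MemLp (fun x => χ x • u i x) 2) {b t : ℝ}
    (hb : 0 < b) (ht : 0 < t) :
    ENNReal.ofReal (expSymbol (4 * b) (t ^ 2)) *
        ∫⁻ x, ‖χ x‖ₑ ^ 2 * ENNReal.ofReal (familyDensity u x) ≤
      ∑ i, heatEnergy b (fun x => χ x • u i x) +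
        phaseSpaceConst E * (ENNReal.ofReal (t ^ (Module.finrank ℝ E + 2)) *
          ∫⁻ x, ‖χ x‖ₑ ^ 2) := by
  have hs : Measurable (expSymbol (4 * b)) := by unfold expSymbol; fun_prop
  have h := phase_space_bound hu hχ hχu (e := ENNReal.ofReal (expSymbol (4 * b) (t ^ 2)))
    (a := fun p => ENNReal.ofReal (expSymbol (4 * b) (4 * π ^ 2 * ‖p‖ ^ 2)))
    (w := fun p => ENNReal.ofReal (t ^ 2 - 4 * π ^ 2 * ‖p‖ ^ 2)) (by fun_prop) (by fun_prop)
    (fun p => by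
      have h1 := expSymbol_sub_le (x := t ^ 2) (y := 4 * π ^ 2 * ‖p‖ ^ 2) (b := 4 * b)
        (by positivity) (by positivity)
      have h2 : ENNReal.ofReal (t ^ 2 - 4 * π ^ 2 * ‖p‖ ^ 2) =
          ENNReal.ofReal (max (t ^ 2 - 4 * π ^ 2 * ‖p‖ ^ 2) 0) := by simp
      rw [h2, ← ENNReal.ofReal_add (expSymbol_nonneg (by positivity) (by positivity))
        (le_max_right _ _)]
      exact ENNReal.ofReal_le_ofReal (by linarith))
  rw [lintegral_sub_sq ht] at h
  simp only [ofReal_familyDensity, heatEnergy_eq hb (hχu _)]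
  refine h.trans (le_of_eq ?_)
  ring

theorem lintegral_density_ne_top (u : ι → Lp ℂ 2 (volume : Measure E)) :
    ∫⁻ x, ENNReal.ofReal (familyDensity u x) ≠ ∞ := by
  simp only [ofReal_familyDensity]
  have hm : ∀ i, Measurable fun x => ‖u i x‖ₑ ^ 2 := fun i =>
    (Lp.stronglyMeasurable (u i)).measurable.enorm.pow_const 2
  rw [lintegral_finsetSum _ fun i _ => hm i]
  simp only [lintegral_enorm_sq_Lp]
  exact ENNReal.sum_ne_top.2 fun i _ => ENNReal.ofReal_ne_top

theorem lintegral_sq_mul_density_le {η : ℝ → ℝ} (hη : IsNormalized η)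
    (hN : profileEnergy η ≠ ∞)
    (hM : ∫⁻ t in Ioi (0 : ℝ), ENNReal.ofReal (η t ^ 2 * t ^ (Module.finrank ℝ E + 1)) ≠ ∞)
    {u : ι → Lp ℂ 2 (volume : Measure E)}
    (hu : ∀ φ : Lp ℂ 2 (volume : Measure E), ∑ i, ‖⟪u i, φ⟫_ℂ‖ ^ 2 ≤ ‖φ‖ ^ 2) {f : E → ℝ}
    (hf : IsMomentumScale (Module.finrank ℝ E) (familyDensity u) f)
    (hfi : ∫⁻ x, ENNReal.ofReal (f x ^ (Module.finrank ℝ E + 2)) ≠ ∞) :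
    ∫⁻ x, ENNReal.ofReal (f x ^ 2) * ENNReal.ofReal (familyDensity u x) ≤
      (1 + ENNReal.ofReal (4 / (Module.finrank ℝ E : ℝ) ^ 2) * profileEnergy η) *
          familyKinetic u +
        phaseSpaceConst E *
          ((∫⁻ t in Ioi (0 : ℝ), ENNReal.ofReal (η t ^ 2 * t ^ (Module.finrank ℝ E + 1))) *
            ∫⁻ x, ENNReal.ofReal (f x ^ (Module.finrank ℝ E + 2))) := by
  set n := Module.finrank ℝ E with hn
  set M := ∫⁻ t in Ioi (0 : ℝ), ENNReal.ofReal (η t ^ 2 * t ^ (n + 1)) with hMdef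
  have h1 := hη.measurable_posPart
  have h2 := hf.measurable
  have hρ := measurable_familyDensity u
  have hχm : Measurable fun z : ℝ × E => ‖posPart η (z.1 / f z.2)‖ₑ ^ 2 := by fun_prop
  have hχm1 : ∀ t, Measurable fun x => posPart η (t / f x) := by fun_prop
  have hA : ∫⁻ t, ENNReal.ofReal (t ^ (n + 2)) * (∫⁻ x, ‖posPart η (t / f x)‖ₑ ^ 2) ∂haarIoi =
      M * ∫⁻ x, ENNReal.ofReal (f x ^ (n + 2)) := by
    have := lintegral_pow_mul_lintegral_profile (n := n + 1) hη hf (w := fun _ => 1)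
      measurable_const
    simpa using this
  have hAm : Measurable fun t => ENNReal.ofReal (t ^ (n + 2)) *
      ∫⁻ x, ‖posPart η (t / f x)‖ₑ ^ 2 :=
    Measurable.mul (by fun_prop) hχm.lintegral_prod_right'
  have hB : ∫⁻ t, ENNReal.ofReal (t ^ 2) *
      (∫⁻ x, ‖posPart η (t / f x)‖ₑ ^ 2 * ENNReal.ofReal (familyDensity u x)) ∂haarIoi =
      ∫⁻ x, ENNReal.ofReal (f x ^ 2) * ENNReal.ofReal (familyDensity u x) := by
    have := lintegral_pow_mul_lintegral_profile (n := 1) hη hf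
      (w := fun x => ENNReal.ofReal (familyDensity u x)) (by fun_prop)
    simpa [hη.norm_mul] using this
  have hχ : ∀ᵐ t ∂haarIoi, MemLp (fun x => posPart η (t / f x)) 2 := by
    have hfin : ∫⁻ t, ENNReal.ofReal (t ^ (n + 2)) *
        (∫⁻ x, ‖posPart η (t / f x)‖ₑ ^ 2) ∂haarIoi ≠ ∞ := by
      rw [hA]
      exact ENNReal.mul_ne_top hM hfi
    filter_upwards [ae_lt_top hAm hfin, ae_haarIoi_pos] with t ht ht0
    rw [memLp_two_iff_lintegral_enorm_sq (hχm1 t).aestronglyMeasurable]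
    refine lt_top_iff_ne_top.2 fun h => ht.ne ?_
    rw [h, ENNReal.mul_top (by simpa using pow_pos ht0 _)]
  have hχρm : Measurable fun z : ℝ × E =>
      ‖posPart η (z.1 / f z.2)‖ₑ ^ 2 * ENNReal.ofReal (familyDensity u z.2) := by fun_prop
  have hCm : Measurable fun t => ∫⁻ x, ‖posPart η (t / f x)‖ₑ ^ 2 *
      ENNReal.ofReal (familyDensity u x) := hχρm.lintegral_prod_right'
  have hC : ∫⁻ t, (∫⁻ x, ‖posPart η (t / f x)‖ₑ ^ 2 *
      ENNReal.ofReal (familyDensity u x)) ∂haarIoi ≤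
      ∫⁻ x, ENNReal.ofReal (familyDensity u x) := by
    rw [lintegral_lintegral_swap hχρm.aemeasurable]
    refine lintegral_mono fun x => ?_
    have hm1 : Measurable fun t => ‖posPart η (t / f x)‖ₑ ^ 2 := by fun_prop
    dsimp only
    rw [lintegral_mul_const _ hm1]
    by_cases hx : familyDensity u x = 0
    · simp [hx]
    · simp only [← ofReal_eq_enorm_sq]
      rw [lintegral_sq_profile hη (hf.pos x hx), one_mul]
  have hχu : ∀ᵐ t ∂haarIoi, ∀ i, MemLp (fun x => posPart η (t / f x) • u i x) 2 := by
    filter_upwards [ae_lt_top hCm (ne_top_of_le_ne_top (lintegral_density_ne_top u) hC)] with t ht i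
    have hm1 : Measurable fun x => posPart η (t / f x) • u i x :=
      (measurable_localized hη h2 (u i)).comp measurable_prodMk_left
    rw [memLp_two_iff_lintegral_enorm_sq hm1.aestronglyMeasurable]
    refine lt_of_le_of_lt (lintegral_mono fun x => ?_) ht
    rw [enorm_smul, mul_pow, ofReal_familyDensity]
    gcongr
    exact Finset.single_le_sum (f := fun i => ‖u i x‖ₑ ^ 2) (fun _ _ => zero_le)
      (Finset.mem_univ i)
  -- The right side does not depend on `b`, which is what Fatou's lemma requires as `b → ∞`.
  have hmain : ∀ b : ℝ, 0 < b → ∫⁻ t, ENNReal.ofReal (expSymbol (4 * b) (t ^ 2)) *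
      (∫⁻ x, ‖posPart η (t / f x)‖ₑ ^ 2 * ENNReal.ofReal (familyDensity u x)) ∂haarIoi ≤
      (1 + ENNReal.ofReal (4 / (n : ℝ) ^ 2) * profileEnergy η) * familyKinetic u +
        phaseSpaceConst E * (M * ∫⁻ x, ENNReal.ofReal (f x ^ (n + 2))) := by
    intro b hb
    calc _ ≤ ∫⁻ t, (∑ i, heatEnergy b (fun x => posPart η (t / f x) • u i x) +
        phaseSpaceConst E * (ENNReal.ofReal (t ^ (n + 2)) *
          ∫⁻ x, ‖posPart η (t / f x)‖ₑ ^ 2)) ∂haarIoi := by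
          refine lintegral_mono_ae ?_
          filter_upwards [hχ, hχu, ae_haarIoi_pos] with t h3 h4 h5
          exact lintegral_localized_le hu h3 h4 hb h5
      _ = _ := lintegral_add_right _ (hAm.const_mul _)
      _ ≤ _ := by
          rw [lintegral_const_mul _ hAm, hA]
          gcongr
          exact (lintegral_sum_heatEnergy_localized_le hη hN hf b).trans
            (by gcongr; exact sum_heatEnergy_le_familyKinetic u hb)
  rw [← hB]
  refine lintegral_le_of_tendsto (F := fun k t =>
    ENNReal.ofReal (expSymbol (4 * ((k : ℝ) + 1)) (t ^ 2)) *
      (∫⁻ x, ‖posPart η (t / f x)‖ₑ ^ 2 * ENNReal.ofReal (familyDensity u x)))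
    (fun k => ?_) ?_ fun k => hmain _ (by positivity)
  · have hs : Measurable (expSymbol (4 * ((k : ℝ) + 1))) := by unfold expSymbol; fun_prop
    exact (Measurable.mul (by fun_prop) hCm).aemeasurable
  · filter_upwards [ae_haarIoi_pos] with t ht
    refine ENNReal.Tendsto.mul_const (ENNReal.tendsto_ofReal ?_)
      (Or.inl (by simpa using ht.ne'))
    refine (tendsto_expSymbol _).comp ?_
    exact (Filter.tendsto_atTop_add_const_right _ _ tendsto_natCast_atTop_atTop).const_mul_atTop
      (by norm_num)

end Family

/-! ### Choice of the momentum scale and the sharp power of the density -/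

section Optimization

open Real

variable {ι : Type*} [Fintype ι]

/-- Truncation is harmless because `s ↦ min s (log l)` is 1-Lipschitz. -/
theorem isMomentumScale_truncated {E : Type*} [MeasurableSpace E] {d : ℕ} (hd : 1 ≤ d)
    {ρ : E → ℝ} (hρ : Measurable ρ) (hρ0 : ∀ x, 0 ≤ ρ x) {c l : ℝ} (hc : 0 < c) (hl : 0 < l) :
    IsMomentumScale d ρ fun x => c * min (ρ x) l ^ (1 / d : ℝ) where
  measurable := by fun_prop
  pos x hx := by
    have := (hρ0 x).lt_of_ne' hx
    positivity
  zero x hx := by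
    have : (d : ℝ) ≠ 0 := by positivity
    rw [hx, min_eq_left hl.le, zero_rpow (by positivity), mul_zero]
  sq_log_sub_le x y hx hy := by
    have hx0 := (hρ0 x).lt_of_ne' hx
    have hy0 := (hρ0 y).lt_of_ne' hy
    have hlog : ∀ z, 0 < ρ z → log (c * min (ρ z) l ^ (1 / d : ℝ)) =
        log c + 1 / d * min (log (ρ z)) (log l) := by
      intro z hz
      have hmz : 0 < min (ρ z) l := lt_min hz hl
      rw [log_mul hc.ne' (by positivity), log_rpow hmz]
      congr 2
      rcases le_total (ρ z) l with h | h
      · rw [min_eq_left h, min_eq_left (log_le_log hz h)]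
      · rw [min_eq_right h, min_eq_right (log_le_log hl h)]
    rw [hlog x hx0, hlog y hy0, add_sub_add_left_eq_sub, ← mul_sub, mul_pow, one_div_pow]
    refine mul_le_mul_of_nonneg_left (sq_le_sq.2 ?_) (by positivity)
    simpa using abs_min_sub_min_le_max (log (ρ x)) (log l) (log (ρ y)) (log l)

theorem IsNormalized.moment_ne_zero {η : ℝ → ℝ} (hη : IsNormalized η) (n : ℕ) :
    ∫⁻ t in Ioi (0 : ℝ), ENNReal.ofReal (η t ^ 2 * t ^ n) ≠ 0 := by
  intro h
  have hm := hη.measurable_posPart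
  have hcongr : ∀ g : ℝ → ℝ, ∫⁻ t in Ioi (0 : ℝ), ENNReal.ofReal (η t ^ 2 * g t) =
      ∫⁻ t in Ioi (0 : ℝ), ENNReal.ofReal (posPart η t ^ 2 * g t) := fun g =>
    setLIntegral_congr_fun measurableSet_Ioi fun t ht => by
      rw [posPart_of_pos η ht]
  rw [hcongr (fun t => t ^ n), lintegral_eq_zero_iff (by fun_prop)] at h
  have h1 := hη.norm_mul
  rw [hcongr (fun t => t), lintegral_eq_zero_iff (by fun_prop) |>.2] at h1
  · exact zero_ne_one h1
  · filter_upwards [h, ae_restrict_mem measurableSet_Ioi] with t ht (ht0 : 0 < t)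
    simp only [Pi.zero_apply, ENNReal.ofReal_eq_zero] at ht ⊢
    have h2 : posPart η t ^ 2 ≤ 0 := by
      by_contra! h3
      exact absurd ht (not_le.2 (mul_pos h3 (pow_pos ht0 n)))
    exact mul_nonpos_of_nonpos_of_nonneg h2 ht0.le

theorem lintegral_truncated_le {d : ℕ} (hd : 1 ≤ d) {η : ℝ → ℝ} (hη : IsNormalized η)
    (hN : profileEnergy η ≠ ∞)
    (hM : ∫⁻ t in Ioi (0 : ℝ), ENNReal.ofReal (η t ^ 2 * t ^ (d + 1)) ≠ ∞)
    {u : ι → L2 d} (hu : ∀ φ : L2 d, ∑ i, ‖⟪u i, φ⟫_ℂ‖ ^ 2 ≤ ‖φ‖ ^ 2) {l : ℝ} (hl : 0 < l) :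
    ENNReal.ofReal (cTF d) *
        ∫⁻ x, ENNReal.ofReal (min (familyDensity u x) l ^ (1 + 2 / d : ℝ)) ≤
      (∫⁻ t in Ioi (0 : ℝ), ENNReal.ofReal (η t ^ 2 * t ^ (d + 1))) ^ (2 / d : ℝ) *
        ((1 + ENNReal.ofReal (4 / (d : ℝ) ^ 2) * profileEnergy η) * familyKinetic u) := by
  have hM0 := hη.moment_ne_zero (d + 1)
  set M := ∫⁻ t in Ioi (0 : ℝ), ENNReal.ofReal (η t ^ 2 * t ^ (d + 1)) with hMdef
  set X := (1 + ENNReal.ofReal (4 / (d : ℝ) ^ 2) * profileEnergy η) * familyKinetic u with hX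
  set r := M.toReal with hr
  have hMr : M = ENNReal.ofReal r := (ENNReal.ofReal_toReal hM).symm
  have hr0 : 0 < r := ENNReal.toReal_pos hM0 hM
  have hd0 : (0 : ℝ) < d := by positivity
  set Γ := Gamma (d / 2 + 1) with hΓ
  have hΓ0 : 0 < Γ := Gamma_pos_of_pos (by positivity)
  -- The maximizer of `c² - A r c^(d+2)`, characterized by `A r c^(d+2) = 2/(d+2) · c²`; the maximum
  -- is `d/(d+2) · c²`.
  set c := 2 * √π * (Γ / r) ^ (1 / d : ℝ) with hc
  have hc0 : 0 < c := by positivity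
  have hcd : c ^ d = (2 * √π) ^ d * (Γ / r) := by
    rw [hc, mul_pow, ← rpow_natCast ((Γ / r) ^ (1 / d : ℝ)), ← rpow_mul (by positivity),
      one_div_mul_cancel hd0.ne', rpow_one]
  have hc2 : c ^ 2 = 4 * π * (Γ / r) ^ (2 / d : ℝ) := by
    rw [hc, mul_pow, mul_pow, sq_sqrt pi_pos.le, ← rpow_natCast ((Γ / r) ^ (1 / d : ℝ)),
      ← rpow_mul (by positivity)]
    norm_num [div_eq_inv_mul, mul_comm]
  have hcTF : r ^ (2 / d : ℝ) * (d / (d + 2) * c ^ 2) = cTF d := by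
    rw [hc2, cTF, div_rpow hΓ0.le hr0.le, hΓ, add_comm (1 : ℝ)]
    field_simp
  set A := 2 / (d + 2) * (1 / (2 * π)) ^ d * (√π ^ d / Γ) with hA
  have hA0 : 0 ≤ A := by positivity
  have hAc : A * r * c ^ (d + 2) = 2 / (d + 2) * c ^ 2 := by
    have h1 : (1 / (2 * π)) ^ d * √π ^ d * (2 * √π) ^ d = 1 := by
      rw [← mul_pow, ← mul_pow]
      have : 1 / (2 * π) * √π * (2 * √π) = 1 := by
        field_simp
        rw [sq_sqrt pi_pos.le]
      rw [this, one_pow]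
    calc A * r * c ^ (d + 2) = ((1 / (2 * π)) ^ d * √π ^ d * (2 * √π) ^ d) *
          (2 / (d + 2) * c ^ 2) := by
          rw [pow_add, hcd, hA]
          field_simp
      _ = _ := by rw [h1, one_mul]
  clear_value c
  set ρ := familyDensity u with hρ
  have hρ0 : ∀ x, 0 ≤ ρ x := familyDensity_nonneg u
  have hρm : Measurable ρ := measurable_familyDensity u
  set m : Space d → ℝ := fun x => min (ρ x) l with hm
  have hm0 : ∀ x, 0 ≤ m x := fun x => le_min (hρ0 x) hl.le
  set J := ∫⁻ x, ENNReal.ofReal (m x ^ (1 + 2 / d : ℝ)) with hJ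
  have hpow : ∀ x, m x ^ (1 + 2 / d : ℝ) = m x * m x ^ (2 / d : ℝ) := by
    intro x
    rw [rpow_add' (hm0 x) (by positivity), rpow_one]
  -- This is the purpose of the truncation: `J` is at most `l^(2/d) ∫ ρ`, so its multiple can be
  -- subtracted below.
  have hJ1 : J ≠ ∞ := by
    refine ne_top_of_le_ne_top (ENNReal.mul_ne_top (ENNReal.ofReal_ne_top (r := l ^ (2 / d : ℝ)))
      (lintegral_density_ne_top u)) ?_
    rw [← lintegral_const_mul' _ _ ENNReal.ofReal_ne_top]
    refine lintegral_mono fun x => ?_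
    rw [← ENNReal.ofReal_mul (by positivity), hpow, mul_comm]
    refine ENNReal.ofReal_le_ofReal (mul_le_mul ?_ (min_le_left _ _) (hm0 x) (by positivity))
    exact rpow_le_rpow (hm0 x) (min_le_right _ _) (by positivity)
  have hfpow : ∀ x, (c * m x ^ (1 / d : ℝ)) ^ (d + 2) = c ^ (d + 2) * m x ^ (1 + 2 / d : ℝ) := by
    intro x
    rw [mul_pow, ← rpow_natCast (m x ^ (1 / d : ℝ)), ← rpow_mul (hm0 x)]
    congr 2
    push_cast
    field_simp
  have hJ2 : ∫⁻ x, ENNReal.ofReal ((c * m x ^ (1 / d : ℝ)) ^ (d + 2)) =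
      ENNReal.ofReal (c ^ (d + 2)) * J := by
    rw [hJ, ← lintegral_const_mul' _ _ ENNReal.ofReal_ne_top]
    refine lintegral_congr fun x => ?_
    rw [hfpow, ENNReal.ofReal_mul (by positivity)]
  have hJ3 : ENNReal.ofReal (c ^ 2) * J ≤
      ∫⁻ x, ENNReal.ofReal ((c * m x ^ (1 / d : ℝ)) ^ 2) * ENNReal.ofReal (ρ x) := by
    rw [hJ, ← lintegral_const_mul' _ _ ENNReal.ofReal_ne_top]
    refine lintegral_mono fun x => ?_
    rw [← ENNReal.ofReal_mul (by positivity), ← ENNReal.ofReal_mul (by positivity), mul_pow,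
      ← rpow_natCast (m x ^ (1 / d : ℝ)), ← rpow_mul (hm0 x), hpow, mul_comm (m x), ← mul_assoc]
    refine ENNReal.ofReal_le_ofReal (mul_le_mul (le_of_eq ?_) (min_le_left _ _) (hm0 x) ?_)
    · congr 2
      push_cast
      ring
    · have := rpow_nonneg (hm0 x) (1 / d * (2 : ℕ) : ℝ)
      positivity
  have hfin : Module.finrank ℝ (Space d) = d := finrank_euclideanSpace_fin
  have hscale := isMomentumScale_truncated hd hρm hρ0 hc0 hl
  have hmain := lintegral_sq_mul_density_le (E := Space d) (u := u) hη hN (by rwa [hfin]) hu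
    (f := fun x => c * m x ^ (1 / d : ℝ)) (by rwa [hfin])
    (by rw [hfin, hJ2]; exact ENNReal.mul_ne_top ENNReal.ofReal_ne_top hJ1)
  simp only [hfin] at hmain
  rw [hJ2, phaseSpaceConst_eq hd, ← hMdef, hMr, ← hX, ← mul_assoc, ← mul_assoc,
    ← ENNReal.ofReal_mul hA0, ← ENNReal.ofReal_mul (by positivity), hAc] at hmain
  have hsplit : c ^ 2 = d / (d + 2) * c ^ 2 + 2 / (d + 2) * c ^ 2 := by
    field_simp
  have h3 := hJ3.trans hmain
  have hJs : ENNReal.ofReal (c ^ 2) * J = ENNReal.ofReal (d / (d + 2) * c ^ 2) * J +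
      ENNReal.ofReal (2 / (d + 2) * c ^ 2) * J := by
    rw [← add_mul, ← ENNReal.ofReal_add (by positivity) (by positivity), ← hsplit]
  rw [hJs] at h3
  have h4 := (ENNReal.add_le_add_iff_right
    (ENNReal.mul_ne_top ENNReal.ofReal_ne_top hJ1)).1 h3
  rw [← hcTF, ENNReal.ofReal_mul (by positivity), hMr, mul_assoc,
    ENNReal.ofReal_rpow_of_pos hr0]
  gcongr

theorem lintegral_familyDensity_le {d : ℕ} (hd : 1 ≤ d) {η : ℝ → ℝ} (hη : IsNormalized η)
    (hN : profileEnergy η ≠ ∞)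
    (hM : ∫⁻ t in Ioi (0 : ℝ), ENNReal.ofReal (η t ^ 2 * t ^ (d + 1)) ≠ ∞)
    {u : ι → L2 d} (hu : ∀ φ : L2 d, ∑ i, ‖⟪u i, φ⟫_ℂ‖ ^ 2 ≤ ‖φ‖ ^ 2) :
    ∫⁻ x, ENNReal.ofReal (cTF d) * ENNReal.ofReal (familyDensity u x ^ (1 + 2 / d : ℝ)) ≤
      (∫⁻ t in Ioi (0 : ℝ), ENNReal.ofReal (η t ^ 2 * t ^ (d + 1))) ^ (2 / d : ℝ) *
        ((1 + ENNReal.ofReal (4 / (d : ℝ) ^ 2) * profileEnergy η) * familyKinetic u) := by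
  have hρ := measurable_familyDensity u
  refine lintegral_le_of_tendsto (F := fun n x => ENNReal.ofReal (cTF d) *
    ENNReal.ofReal (min (familyDensity u x) (n + 1 : ℝ) ^ (1 + 2 / d : ℝ))) (fun n => ?_) ?_
    fun n => ?_
  · exact Measurable.aemeasurable (by fun_prop)
  · refine .of_forall fun x => tendsto_const_nhds.congr' ?_
    filter_upwards [Filter.eventually_ge_atTop ⌈familyDensity u x⌉₊] with n hn
    rw [min_eq_left ((Nat.ceil_le.1 hn).trans (by linarith))]
  · rw [lintegral_const_mul' _ _ ENNReal.ofReal_ne_top]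
    exact lintegral_truncated_le hd hη hN hM hu (by positivity)

end Optimization

/-! ### From operators to families: square root, density and trace -/

section Operators

open FourierTransform Real
open scoped ContDiff

/-- Distinct basis vectors are at distance `√2`, so balls of radius `1/2` around them are disjoint.
-/
theorem countable_of_hilbertBasis {H : Type*} [NormedAddCommGroup H] [InnerProductSpace ℂ H]
    [TopologicalSpace.SeparableSpace H] {ι : Type*} (b : HilbertBasis ι ℂ H) : Countable ι := by
  refine Pairwise.countable_of_isOpen_disjoint (s := fun i => Metric.ball (b i) (1 / 2))
    (fun i j hij => Metric.ball_disjoint_ball ?_) (fun i => Metric.isOpen_ball)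
    fun i => ⟨b i, Metric.mem_ball_self (by norm_num)⟩
  have h := norm_sub_sq (𝕜 := ℂ) (b i) (b j)
  rw [b.orthonormal.norm_eq_one, b.orthonormal.norm_eq_one, b.orthonormal.inner_eq_zero hij] at h
  simp only [map_zero] at h
  rw [dist_eq_norm]
  nlinarith [norm_nonneg (b i - b j)]

theorem eq_of_inner_eq_of_denseRange {H : Type*} [NormedAddCommGroup H]
    [InnerProductSpace ℂ H] {α : Type*} {e : α → H} (he : DenseRange e)
    {T₁ T₂ : H →L[ℂ] H} (h : ∀ φ ψ, ⟪e φ, T₁ (e ψ)⟫_ℂ = ⟪e φ, T₂ (e ψ)⟫_ℂ) : T₁ = T₂ := by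
  refine ContinuousLinearMap.coeFn_injective (he.equalizer T₁.continuous T₂.continuous (funext fun ψ => ?_))
  refine ext_inner_left ℂ fun w => ?_
  exact congrFun (he.equalizer (g := fun w => ⟪w, T₁ (e ψ)⟫_ℂ) (h := fun w => ⟪w, T₂ (e ψ)⟫_ℂ)
    (by fun_prop) (by fun_prop) (funext fun φ => h φ ψ)) w

section Hilbert

variable {H : Type*} [NormedAddCommGroup H] [InnerProductSpace ℂ H] [CompleteSpace H]

open ContinuousLinearMap

theorem tsum_ofReal_sq_norm_adjoint {ι : Type*} (b : HilbertBasis ι ℂ H) (T : H →L[ℂ] H) :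
    ∑' i, ENNReal.ofReal (‖adjoint T (b i)‖ ^ 2) = ∑' i, ENNReal.ofReal (‖T (b i)‖ ^ 2) := by
  simp only [ofReal_sq_norm_eq_tsum b]
  rw [ENNReal.tsum_comm]
  refine tsum_congr fun j => tsum_congr fun i => ?_
  rw [adjoint_inner_right, norm_inner_symm]

theorem re_inner_adjoint_mul_self (T : H →L[ℂ] H) (x : H) :
    (⟪x, (adjoint T * T) x⟫_ℂ).re = ‖T x‖ ^ 2 := by
  rw [mul_apply_eq_comp, adjoint_inner_right, inner_self_eq_norm_sq_to_K]
  simp [← Complex.ofReal_pow]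

theorem posTrace_sum_adjoint_mul_self {ι κ : Type*} [Fintype κ] (b : HilbertBasis ι ℂ H)
    (T : κ → H →L[ℂ] H) : posTrace (∑ j, adjoint (T j) * T j) =
      ∑' i, ∑ j, ENNReal.ofReal (‖T j (b i)‖ ^ 2) := by
  have h0 : 0 ≤ ∑ j, adjoint (T j) * T j := Finset.sum_nonneg fun j _ => by
    rw [← star_eq_adjoint]
    exact star_mul_self_nonneg (T j)
  rw [posTrace_eq_traceOver b h0, traceOver]
  refine tsum_congr fun i => ?_
  rw [← ENNReal.ofReal_sum_of_nonneg fun j _ => by positivity, sum_apply, inner_sum, Complex.re_sum]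
  simp only [re_inner_adjoint_mul_self]

theorem posTrace_adjoint_mul_self {ι : Type*} (b : HilbertBasis ι ℂ H) (T : H →L[ℂ] H) :
    posTrace (adjoint T * T) = ∑' i, ENNReal.ofReal (‖T (b i)‖ ^ 2) := by
  simpa using posTrace_sum_adjoint_mul_self b fun _ : Unit => T

theorem exists_selfAdjoint_sqrt {γ : H →L[ℂ] H} (hγ : 0 ≤ γ) :
    ∃ S : H →L[ℂ] H, adjoint S = S ∧ S * S = γ :=
  ⟨CFC.sqrt γ, (CFC.sqrt_nonneg γ).isSelfAdjoint, CFC.sqrt_mul_sqrt_self γ hγ⟩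

theorem norm_apply_le_of_mul_self_le_one {S : H →L[ℂ] H} (hS : adjoint S = S) (h1 : S * S ≤ 1)
    (x : H) : ‖S x‖ ≤ ‖x‖ := by
  refine le_of_sq_le_sq ?_ (norm_nonneg _)
  have h := ((le_def (S * S) 1).1 h1).re_inner_nonneg_right x
  have h2 := re_inner_adjoint_mul_self S x
  rw [hS] at h2
  have h3 : (⟪x, (1 : H →L[ℂ] H) x⟫_ℂ).re = ‖x‖ ^ 2 := by
    change (⟪x, x⟫_ℂ).re = _
    rw [inner_self_eq_norm_sq_to_K]
    simp [← Complex.ofReal_pow]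
  rw [sub_apply, inner_sub_right, map_sub, RCLike.re_eq_complex_re, h2,
    h3] at h
  linarith

/-- The exclusion principle: `γ ≤ 1` makes `S` a contraction, and moving it onto `φ` leaves Bessel's
inequality. -/
theorem sum_norm_inner_sq_le {ι : Type*} (b : HilbertBasis ι ℂ H) {S : H →L[ℂ] H}
    (hS : adjoint S = S) (h1 : S * S ≤ 1) (F : Finset ι) (φ : H) :
    ∑ i : F, ‖⟪S (b i), φ⟫_ℂ‖ ^ 2 ≤ ‖φ‖ ^ 2 := by
  have h2 : ∀ i, ⟪S (b i), φ⟫_ℂ = ⟪b i, S φ⟫_ℂ := fun i => by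
    rw [← adjoint_inner_right, hS]
  simp only [h2]
  rw [Finset.sum_coe_sort F fun i => ‖⟪b i, S φ⟫_ℂ‖ ^ 2]
  exact (b.orthonormal.sum_inner_products_le _).trans
    (pow_le_pow_left₀ (norm_nonneg _) (norm_apply_le_of_mul_self_le_one hS h1 φ) 2)

theorem inner_mul_self_apply {S : H →L[ℂ] H} (hS : adjoint S = S) (x y : H) :
    ⟪x, (S * S) y⟫_ℂ = ⟪S x, S y⟫_ℂ := by
  rw [← adjoint_inner_right, hS, mul_apply_eq_comp]

theorem exists_extension_of_norm_le {V : Type*} [AddCommGroup V] [Module ℂ V] {e : V →ₗ[ℂ] H}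
    (he : DenseRange e) {D : V →ₗ[ℂ] H} {C : ℝ} (h : ∀ ψ, ‖D ψ‖ ≤ C * ‖e ψ‖) :
    ∃ B : H →L[ℂ] H, ∀ ψ, B (e ψ) = D ψ :=
  ⟨D.extendOfNorm e, fun ψ => D.extendOfNorm_eq (e := e) he ⟨C, h⟩ ψ⟩

/-- A bounded form `∑ ⟨Dⱼ φ, Dⱼ ψ⟩` on a dense subspace factors through bounded operators. -/
theorem exists_factors_of_form {κ : Type*} [Fintype κ] {V : Type*} [AddCommGroup V] [Module ℂ V]
    {e : V →ₗ[ℂ] H} (he : DenseRange e) {D : κ → V →ₗ[ℂ] H} {K : H →L[ℂ] H}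
    (hK : ∀ φ ψ, ⟪e φ, K (e ψ)⟫_ℂ = ∑ j, ⟪D j φ, D j ψ⟫_ℂ) :
    ∃ B : κ → H →L[ℂ] H, (∀ j ψ, B j (e ψ) = D j ψ) ∧ K = ∑ j, adjoint (B j) * B j := by
  have hbound : ∀ j ψ, ‖D j ψ‖ ≤ √‖K‖ * ‖e ψ‖ := by
    intro j ψ
    refine le_of_sq_le_sq ?_ (by positivity)
    rw [mul_pow, sq_sqrt (norm_nonneg K)]
    have h2 : ∑ j, ‖D j ψ‖ ^ 2 = (⟪e ψ, K (e ψ)⟫_ℂ).re := by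
      rw [hK]
      simp [inner_self_eq_norm_sq_to_K, ← Complex.ofReal_pow]
    calc ‖D j ψ‖ ^ 2 ≤ ∑ j, ‖D j ψ‖ ^ 2 :=
          Finset.single_le_sum (f := fun j => ‖D j ψ‖ ^ 2) (fun _ _ => by positivity)
            (Finset.mem_univ j)
      _ ≤ ‖e ψ‖ * ‖K (e ψ)‖ := by
          rw [h2]
          exact (Complex.re_le_norm _).trans (norm_inner_le_norm _ _)
      _ ≤ ‖e ψ‖ * (‖K‖ * ‖e ψ‖) := by gcongr; exact K.le_opNorm _
      _ = _ := by ring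
  choose B hB using fun j => exists_extension_of_norm_le he (hbound j)
  refine ⟨B, hB, eq_of_inner_eq_of_denseRange he fun φ ψ => ?_⟩
  rw [hK, sum_apply, inner_sum]
  refine Finset.sum_congr rfl fun j _ => ?_
  rw [mul_apply_eq_comp, adjoint_inner_right, hB, hB]

end Hilbert

variable {d : ℕ}

theorem adjoint_indicatorOp {A : Set (Space d)} (hA : MeasurableSet A) :
    ContinuousLinearMap.adjoint (indicatorOp hA) = indicatorOp hA := by
  refine (ContinuousLinearMap.eq_adjoint_iff _ _).2 (fun f g => ?_) |>.symm
  rw [L2.inner_def, L2.inner_def]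
  refine integral_congr_ae ?_
  have h (f : L2 d) : indicatorOp hA f =ᵐ[volume] A.indicator f :=
    ((Lp.memLp f).indicator hA).coeFn_toLp
  filter_upwards [h f, h g] with x hf hg
  rw [hf, hg]
  by_cases hx : x ∈ A <;> simp [hx]

theorem ofReal_norm_sq_indicatorOp {A : Set (Space d)} (hA : MeasurableSet A) (f : L2 d) :
    ENNReal.ofReal (‖indicatorOp hA f‖ ^ 2) = ∫⁻ x in A, ‖f x‖ₑ ^ 2 := by
  rw [← lintegral_enorm_sq_Lp, ← lintegral_indicator hA]
  refine lintegral_congr_ae ?_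
  have h : indicatorOp hA f =ᵐ[volume] A.indicator f :=
    ((Lp.memLp f).indicator hA).coeFn_toLp
  filter_upwards [h] with x hx
  rw [hx]
  by_cases hxA : x ∈ A <;> simp [hxA]

/-- Both sides have the same integral over every `A`: the trace of `1_A S² 1_A` equals `∑ ‖1_A S
bᵢ‖²`, since an operator and its adjoint have the same Hilbert–Schmidt norm. -/
theorem IsDensity.ae_eq_tsum {S : L2 d →L[ℂ] L2 d} {ρ : Space d → ℝ}
    (hS : ContinuousLinearMap.adjoint S = S) (hρ : IsDensity (S * S) ρ) {ι : Type*} [Countable ι] (b : HilbertBasis ι ℂ (L2 d)) :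
    (fun x => ENNReal.ofReal (ρ x)) =ᵐ[volume] fun x => ∑' i, ‖S (b i) x‖ₑ ^ 2 := by
  have hm : ∀ i, Measurable fun x => ‖S (b i) x‖ₑ ^ 2 := fun i =>
    (Lp.stronglyMeasurable _).measurable.enorm.pow_const 2
  refine ae_eq_of_forall_setLIntegral_eq_of_sigmaFinite₀
    hρ.integrable.aestronglyMeasurable.aemeasurable.ennreal_ofReal
    (Measurable.tsum hm).aemeasurable fun A hA _ => ?_
  rw [← hρ.trace_eq A hA, lintegral_tsum fun i => (hm i).aemeasurable]
  simp only [← ofReal_norm_sq_indicatorOp hA]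
  have h1 : ContinuousLinearMap.adjoint (S * indicatorOp hA) =
      indicatorOp hA * S := by
    rw [← ContinuousLinearMap.star_eq_adjoint, star_mul, ContinuousLinearMap.star_eq_adjoint,
      ContinuousLinearMap.star_eq_adjoint, adjoint_indicatorOp, hS]
  have h2 : indicatorOp hA * (S * S) * indicatorOp hA =
      ContinuousLinearMap.adjoint (S * indicatorOp hA) *
        (S * indicatorOp hA) := by
    simp only [h1, mul_assoc]
  rw [h2, posTrace_adjoint_mul_self b, ← tsum_ofReal_sq_norm_adjoint b, h1]
  rfl

/-- If `∂ⱼ u = -v` weakly, then the `j`-th part of the kinetic energy of `u` is `‖v‖²`. -/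
theorem lintegral_sq_mul_fourier_of_weakDeriv {u v : L2 d} {j : Fin d}
    (h : ∀ ψ : 𝓢(Space d, ℂ),
      ⟪(∂_{EuclideanSpace.single j (1 : ℝ)} ψ).toLp 2, u⟫_ℂ = ⟪ψ.toLp 2, v⟫_ℂ) :
    ∫⁻ p : Space d, ENNReal.ofReal (4 * π ^ 2 * p j ^ 2) * ‖fourierLp u p‖ₑ ^ 2 =
      ENNReal.ofReal (‖v‖ ^ 2) := by
  have hfu : LocallyIntegrable (fourierLp u) := (Lp.memLp _).locallyIntegrable (by norm_num)
  have hfv : LocallyIntegrable (fourierLp v) := (Lp.memLp _).locallyIntegrable (by norm_num)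
  have e1 : ∀ (φ : 𝓢(Space d, ℂ)) (w : L2 d),
      ⟪(𝓕⁻ φ).toLp 2, w⟫_ℂ = ∫ x, (starRingEnd ℂ) (φ x) * fourierLp w x := by
    intro φ w
    rw [← SchwartzMap.toLp_fourierInv_eq, ← Lp.inner_fourier_eq, fourier_fourierInv_eq, L2.inner_def]
    refine integral_congr_ae ?_
    filter_upwards [φ.coeFn_toLp 2 volume] with x hx
    rw [hx, RCLike.inner_apply, mul_comm]
    rfl
  have hloc : LocallyIntegrable fun p : Space d =>
      -(2 * π * p j * Complex.I) * fourierLp u p := by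
    refine locallyIntegrable_iff.2 fun k hk => ?_
    exact (hfu.integrableOn_isCompact hk).continuousOn_mul
      (g := fun p : Space d => -(2 * π * p j * Complex.I)) (by fun_prop) hk
  have hae : ∀ᵐ p, fourierLp v p = -(2 * π * p j * Complex.I) * fourierLp u p := by
    refine ae_eq_of_integral_contDiff_smul_eq hfv hloc fun g hg hc => ?_
    have hg' : ContDiff ℝ ∞ (fun x => (g x : ℂ)) := Complex.ofRealCLM.contDiff.comp hg
    have hc' : HasCompactSupport (fun x => (g x : ℂ)) := hc.comp_left (g := Complex.ofReal) rfl
    -- Testing with an inverse Fourier transform moves both pairings to momentum space, where the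
    -- derivative is a multiplication.
    have h1 := h (𝓕⁻ (hc'.toSchwartzMap hg'))
    rw [SchwartzMap.lineDerivOp_fourierInv_eq, e1, e1] at h1
    have ht : (inner ℝ · (EuclideanSpace.single j (1 : ℝ)) : Space d → ℝ).HasTemperateGrowth := by
      fun_prop
    refine Eq.trans (Eq.trans ?_ h1.symm) ?_ <;> refine integral_congr_ae (.of_forall fun p => ?_)
    · simp [Complex.real_smul]
    · simp [Complex.real_smul, ht, SchwartzMap.smulLeftCLM_apply_apply]
      rw [EuclideanSpace.inner_single_right, Complex.conj_ofNat]
      simp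
      ring
  rw [← lintegral_enorm_sq_Lp, ← lintegral_enorm_sq_fourier]
  refine lintegral_congr_ae ?_
  filter_upwards [hae] with p hp
  rw [hp, enorm_mul, mul_pow]
  congr 1
  rw [← ofReal_norm, ← ENNReal.ofReal_pow (norm_nonneg _)]
  congr 1
  simp [abs_of_pos pi_pos, mul_pow]
  norm_num

theorem denseRange_toLp_two : DenseRange (SchwartzMap.toLpCLM ℂ ℂ 2 (volume : Measure (Space d))) :=
  SchwartzMap.denseRange_toLpCLM (E := Space d) (F := ℂ) (p := 2) (μ := volume) (by norm_num)

theorem IsNegGradGrad.exists_factors {S K : L2 d →L[ℂ] L2 d}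
    (hS : ContinuousLinearMap.adjoint S = S) (hK : IsNegGradGrad (S * S) K) : ∃ B : Fin d → L2 d →L[ℂ] L2 d,
      (∀ j, ∀ ψ : 𝓢(Space d, ℂ), B j (ψ.toLp 2) =
        S ((∂_{EuclideanSpace.single j (1 : ℝ)} ψ).toLp 2)) ∧
      K = ∑ j, ContinuousLinearMap.adjoint (B j) * B j := by
  refine exists_factors_of_form
    (e := (SchwartzMap.toLpCLM ℂ ℂ 2 (volume : Measure (Space d))).toLinearMap)
    (D := fun j => S.toLinearMap ∘ₗ
      (SchwartzMap.toLpCLM ℂ ℂ 2 (volume : Measure (Space d))).toLinearMap ∘ₗ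
      (LineDeriv.lineDerivOpCLM ℂ 𝓢(Space d, ℂ) (EuclideanSpace.single j (1 : ℝ))).toLinearMap)
    denseRange_toLp_two fun φ ψ => ?_
  refine (hK φ ψ).trans (Finset.sum_congr rfl fun j _ => ?_)
  exact inner_mul_self_apply hS _ _

theorem adjoint_factor_weakDeriv {S B : L2 d →L[ℂ] L2 d} (hS : ContinuousLinearMap.adjoint S = S)
    {j : Fin d} (hB : ∀ ψ : 𝓢(Space d, ℂ), B (ψ.toLp 2) =
      S ((∂_{EuclideanSpace.single j (1 : ℝ)} ψ).toLp 2)) (f : L2 d) (ψ : 𝓢(Space d, ℂ)) :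
    ⟪(∂_{EuclideanSpace.single j (1 : ℝ)} ψ).toLp 2, S f⟫_ℂ =
      ⟪ψ.toLp 2, ContinuousLinearMap.adjoint B f⟫_ℂ := by
  rw [ContinuousLinearMap.adjoint_inner_right, hB, ← ContinuousLinearMap.adjoint_inner_right, hS]

/-- With `Bⱼ` the bounded extension of `S ∂ⱼ`, one has `K = ∑ Bⱼ* Bⱼ` and, weakly, `∂ⱼ S bᵢ = -Bⱼ*
bᵢ`. Passing to adjoints inside the Hilbert–Schmidt norm gives the trace of `K`. -/
theorem familyKinetic_le_posTrace {S K : L2 d →L[ℂ] L2 d}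
    (hS : ContinuousLinearMap.adjoint S = S) (hK : IsNegGradGrad (S * S) K) {ι : Type*}
    (b : HilbertBasis ι ℂ (L2 d)) (F : Finset ι) :
    familyKinetic (fun i : F => S (b i)) ≤ posTrace K := by
  obtain ⟨B, hB, rfl⟩ := hK.exists_factors hS
  have h1 : ∀ i, ∫⁻ p : Space d, ENNReal.ofReal (4 * π ^ 2 * ‖p‖ ^ 2) *
      ‖fourierLp (S (b i)) p‖ₑ ^ 2 =
      ∑ j, ENNReal.ofReal (‖ContinuousLinearMap.adjoint (B j) (b i)‖ ^ 2) := by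
    intro i
    have hm : Measurable fun p => ‖fourierLp (S (b i)) p‖ₑ ^ 2 :=
      (Lp.stronglyMeasurable _).measurable.enorm.pow_const 2
    have hm2 : ∀ j : Fin d, Measurable fun p : Space d =>
        ENNReal.ofReal (4 * π ^ 2 * p j ^ 2) * ‖fourierLp (S (b i)) p‖ₑ ^ 2 := fun j =>
      Measurable.mul (by fun_prop) hm
    simp only [← fun j => lintegral_sq_mul_fourier_of_weakDeriv
      (adjoint_factor_weakDeriv hS (hB j) (b i))]
    rw [← lintegral_finsetSum _ fun j _ => hm2 j]
    refine lintegral_congr fun p => ?_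
    rw [← Finset.sum_mul, ← ENNReal.ofReal_sum_of_nonneg fun j _ => by positivity,
      EuclideanSpace.norm_sq_eq, Finset.mul_sum]
    simp
  rw [posTrace_sum_adjoint_mul_self b B, familyKinetic]
  simp only [h1]
  rw [Finset.sum_coe_sort F fun i =>
    ∑ j, ENNReal.ofReal (‖ContinuousLinearMap.adjoint (B j) (b i)‖ ^ 2)]
  refine (ENNReal.sum_le_tsum F).trans (le_of_eq ?_)
  rw [Summable.tsum_finsetSum fun _ _ => ENNReal.summable,
    Summable.tsum_finsetSum fun _ _ => ENNReal.summable]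
  exact Finset.sum_congr rfl fun j _ => tsum_ofReal_sq_norm_adjoint b (B j)

theorem lintegral_density_le {S K : L2 d →L[ℂ] L2 d} (hd : 1 ≤ d)
    (hS : ContinuousLinearMap.adjoint S = S) (hS1 : S * S ≤ 1) {ρ : Space d → ℝ}
    (hρ : IsDensity (S * S) ρ) (hK : IsNegGradGrad (S * S) K) {η : ℝ → ℝ} (hη : IsNormalized η)
    (hN : profileEnergy η ≠ ⊤)
    (hM : ∫⁻ t in Ioi (0 : ℝ), ENNReal.ofReal (η t ^ 2 * t ^ (d + 1)) ≠ ⊤) :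
    ∫⁻ x, ENNReal.ofReal (cTF d) * ENNReal.ofReal (ρ x ^ (1 + 2 / d : ℝ)) ≤
      (∫⁻ t in Ioi (0 : ℝ), ENNReal.ofReal (η t ^ 2 * t ^ (d + 1))) ^ (2 / d : ℝ) *
        ((1 + ENNReal.ofReal (4 / (d : ℝ) ^ 2) * profileEnergy η) * posTrace K) := by
  have : Fact ((2 : ℝ≥0∞) ≠ ⊤) := ⟨by norm_num⟩
  obtain ⟨w, b, -⟩ := exists_hilbertBasis ℂ (L2 d)
  have := countable_of_hilbertBasis b
  -- Finite subsets along a sequence exhaust the basis; the bound is uniform in the subset, so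
  -- Fatou's lemma applies.
  obtain ⟨F, hF⟩ := Filter.exists_seq_tendsto (Filter.atTop : Filter (Finset w))
  have hexp : (0 : ℝ) ≤ 1 + 2 / d := by positivity
  refine lintegral_le_of_tendsto (F := fun n x => ENNReal.ofReal (cTF d) *
    ENNReal.ofReal (familyDensity (fun i : F n => S (b i)) x ^ (1 + 2 / d : ℝ)))
    (fun n => ?_) ?_ fun n => ?_
  · have := measurable_familyDensity (fun i : F n => S (b i))
    exact Measurable.aemeasurable (by fun_prop)
  · filter_upwards [hρ.ae_eq_tsum hS b, hρ.nonneg] with x hx hx0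
    refine ENNReal.Tendsto.const_mul (ENNReal.tendsto_ofReal ?_) (Or.inr ENNReal.ofReal_ne_top)
    refine Filter.Tendsto.rpow_const ?_ (Or.inr hexp)
    have h1 : Filter.Tendsto (fun G : Finset w => ∑ i ∈ G, ‖S (b i) x‖ₑ ^ 2) Filter.atTop
        (nhds (ENNReal.ofReal (ρ x))) := by
      rw [hx]
      exact ENNReal.summable.hasSum
    have h2 := (ENNReal.tendsto_toReal ENNReal.ofReal_ne_top).comp (h1.comp hF)
    rw [ENNReal.toReal_ofReal hx0] at h2
    refine h2.congr fun n => ?_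
    have h3 := ofReal_familyDensity (fun i : F n => S (b i)) x
    rw [Finset.sum_coe_sort (F n) fun i => ‖S (b i) x‖ₑ ^ 2] at h3
    rw [Function.comp, Function.comp, ← h3, ENNReal.toReal_ofReal (familyDensity_nonneg _ x)]
  · refine (lintegral_familyDensity_le hd hη hN hM (u := fun i : F n => S (b i))
      (sum_norm_inner_sq_le b hS hS1 (F n))).trans ?_
    gcongr
    exact familyKinetic_le_posTrace hS hK b (F n)

end Operators

end LiebThirring

/-! ### Supremum over the profiles -/

open LiebThirring in
theorem corollary1 (d : ℕ) (hd : 1 ≤ d) (γ : L2 d →L[ℂ] L2 d) (ρ : Space d → ℝ)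
    (hγ_tc : IsTraceClass γ) (hγ_nonneg : 0 ≤ γ) (hγ_le_one : γ ≤ 1) (hρ : IsDensity γ ρ) :
    ENNReal.ofReal (cTF d) * rConst d * ∫⁻ x, ENNReal.ofReal (ρ x ^ (1 + 2 / d : ℝ)) ≤
      kineticEnergy γ := by
  obtain ⟨S, hS, rfl⟩ := exists_selfAdjoint_sqrt hγ_nonneg
  refine le_iInf₂ fun K hK => ?_
  rw [mul_right_comm, rConst, ENNReal.mul_iSup]
  refine iSup_le fun η => ?_
  rw [ENNReal.mul_iSup]
  refine iSup_le fun hη => ?_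
  change _ * (1 / _ * (1 / (1 + ENNReal.ofReal (4 / (d : ℝ) ^ 2) * profileEnergy η))) ≤ _
  have hd0 : (0 : ℝ) < d := by exact_mod_cast hd
  have hM0 := hη.moment_ne_zero (d + 1)
  set M := ∫⁻ t in Ioi (0 : ℝ), ENNReal.ofReal (η t ^ 2 * t ^ (d + 1)) with hMdef
  -- A profile with an infinite moment, or below with infinite energy, contributes `1 / ∞ = 0`.
  by_cases hM : M = ∞
  · rw [hM, ENNReal.top_rpow_of_pos (by positivity)]
    simp
  by_cases hN : profileEnergy η = ∞
  · rw [hN, ENNReal.mul_top (ENNReal.ofReal_pos.2 (by positivity)).ne', add_top]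
    simp
  have h := lintegral_density_le hd hS hγ_le_one hρ hK hη hN hM
  rw [lintegral_const_mul' _ _ ENNReal.ofReal_ne_top, ← hMdef, ← mul_assoc] at h
  set N := 1 + ENNReal.ofReal (4 / (d : ℝ) ^ 2) * profileEnergy η with hNdef
  have hMp1 : M ^ (2 / d : ℝ) ≠ ∞ := ENNReal.rpow_ne_top_of_nonneg (by positivity) hM
  have hMp0 : M ^ (2 / d : ℝ) ≠ 0 := by simp [ENNReal.rpow_eq_zero_iff, hM0, hM]
  rw [one_div, one_div, ← ENNReal.mul_inv (Or.inl hMp0) (Or.inl hMp1), ← div_eq_mul_inv]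
  refine ENNReal.div_le_of_le_mul ?_
  rwa [mul_comm (posTrace K)]
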